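/- **Setting.** Let $n\ge 1$, $T\ge 1$, $d\ge 0$ be integers. Let $f_1,\dots,f_n:\mathbb R^d\to\mathbb R$ be differentiable with $\|\nabla f_i(x)-\nabla f_i(y)\|\le L\|x-y\|$ for all $x,y$ and $i$ ($L>0$), and let $f=\frac1n\sum_{i=1}^n f_i$ be bounded from below, $f^*=\inf f$. Worker $i$ has stochastic gradients $\nabla f_i(x,\xi)$, $\xi\sim\mathcal D_i$, jointly measurable in $(x,\xi)$, that are unbiased and $\sigma$-sub-Gaussian ($\sigma\ge0$): for every $x\in\mathbb R^d$, $$\mathbb E[\nabla f_i(x,\xi)]=\nabla f_i(x),\qquad \mathbb E\exp\!\big(\|\nabla f_i(x,\xi)-\nabla f_i(x)\|^2/\sigma^2\big)\le e ,$$ where for $\sigma=0$ the second condition means $\nabla f_i(x,\xi)=\nabla f_i(x)$ almost surely. The samples $\xi_i^t\sim\mathcal D_i$ are independent over all workers $i$ and iterations $t$. For $\tau>0$ let $\mathrm{clip}_\tau(x)=\frac{\tau}{\|x\|}x$ if $\|x\|>\tau$ and $\mathrm{clip}_\tau(x)=x$ otherwise. Clip21-SGD2M without DP noise, with step size $\gamma>0$,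 momentum parameters $\beta,\hat\beta\in(0,1]$ and clipping level $\tau$, starts from $x^0\in\mathbb R^d$, $g^0=g_i^0=v_i^0=0$ and iterates $$x^{t+1}=x^t-\gamma g^t,\quad v_i^{t+1}=(1-\beta)v_i^t+\beta\nabla f_i(x^{t+1},\xi_i^{t+1}),\quad g_i^{t+1}=g_i^t+\hat\beta\,\mathrm{clip}_\tau(v_i^{t+1}-g_i^t),$$ $$g^{t+1}=g^t+\frac{\hat\beta}{n}\sum_{i=1}^n\mathrm{clip}_\tau(v_i^{t+1}-g_i^t).$$ **Theorem.** There is an absolute constant $k\in\mathbb N$, and for every $\hat\beta\in(0,1]$ (in particular for $\hat\beta=1$) a constant $C>0$ depending only on $\hat\beta$, such that the following holds. Let $\Delta>0$ satisfy $\Delta\ge f(x^0)-f^*$, let $B=\max_i\|\nabla f_i(x^0)\|$, $\tau>0$ and $\alpha\in(0,1)$. Then there are a step size $\gamma>0$ and a momentum parameter $\beta\in(0,1]$, depending only on $n,T,L,\Delta,B,\tau,\sigma,\alpha,\hat\beta$, such that with probability at least $1-\alpha$ the iterates of Clip21-SGD2M satisfy $$\frac1T\sum_{t=0}^{T-1}\|\nabla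 f(x^t)\|^2\le C\,\log^k\!\Big(\frac{12n(T+1)}{\alpha}\Big)\left(\frac{L\Delta(1+B/\tau)}{T}+\frac{\sigma(\sqrt{L\Delta}+B+\sigma)}{\sqrt{nT}}+\frac{L\Delta(\sqrt{L\Delta}+\sigma)}{\tau T}\right).$$ No bound on the gradients or on the heterogeneity of the $f_i$ is assumed. -/

import Mathlib

open MeasureTheory ProbabilityTheory

namespace Clip21

noncomputable section

/-- The space `ℝ^d` with its Euclidean norm. -/
abbrev E (d : ℕ) : Type := EuclideanSpace ℝ (Fin d)

/-- The average loss `f(x) = (1/n) ∑ᵢ fᵢ(x)`. -/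
def avgLoss {n d : ℕ} (f : Fin n → E d → ℝ) (x : E d) : ℝ :=
  (1 / (n : ℝ)) * ∑ i, f i x

/-- Every local loss is differentiable with an `L`-Lipschitz gradient, and the average loss is
bounded from below. -/
structure SmoothProblem {n d : ℕ} (L : ℝ) (f : Fin n → E d → ℝ) : Prop where
  differentiable : ∀ i, Differentiable ℝ (f i)
  smooth : ∀ i x y, ‖gradient (f i) x - gradient (f i) y‖ ≤ L * ‖x - y‖
  bddBelow : BddBelow (Set.range (avgLoss f))

/-- The stochastic gradient `G i x ξ` of worker `i`, where `ξ` has law `D i`, is an unbiased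
`σ`-sub-Gaussian estimator of `∇fᵢ(x)`: `E[exp(‖G i x ξ - ∇fᵢ(x)‖² / σ²)] ≤ exp 1`.
The last field says what this inequality means for `σ = 0`, with the conventions `0 / 0 = 0` and
`c / 0 = ∞` for `c > 0`. -/
structure SubGaussianOracle {n d : ℕ} {Ξ : Type*} [MeasurableSpace Ξ] (σ : ℝ)
    (f : Fin n → E d → ℝ) (D : Fin n → Measure Ξ) (G : Fin n → E d → Ξ → E d) : Prop where
  measurable : ∀ i, Measurable (fun p : E d × Ξ => G i p.1 p.2)
  integrable : ∀ i x, Integrable (G i x) (D i)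
  unbiased : ∀ i x, ∫ s, G i x s ∂(D i) = gradient (f i) x
  subGaussian : ∀ i x,
    ∫⁻ s, ENNReal.ofReal (Real.exp (‖G i x s - gradient (f i) x‖ ^ 2 / σ ^ 2)) ∂(D i)
      ≤ ENNReal.ofReal (Real.exp 1)
  noiseless : σ = 0 → ∀ i x, ∀ᵐ s ∂(D i), G i x s = gradient (f i) x

/-- The samples `ξ t i` (iteration `t`, worker `i`) are jointly independent over all iterations and
workers, and those of worker `i` have law `D i`. -/
structure IndepSamples {n : ℕ} {Ξ Ω : Type*} [MeasurableSpace Ξ] [MeasurableSpace Ω]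
    (P : Measure Ω) (D : Fin n → Measure Ξ) (ξ : ℕ → Fin n → Ω → Ξ) : Prop where
  measurable : ∀ t i, Measurable (ξ t i)
  law : ∀ t i, P.map (ξ t i) = D i
  indep : iIndepFun (fun p : ℕ × Fin n => ξ p.1 p.2) P

/-- The clipping operator. -/
def clip {d : ℕ} (τ : ℝ) (x : E d) : E d :=
  if τ < ‖x‖ then (τ / ‖x‖) • x else x

/-- The variables of Clip21-SGD2M: the iterate `x`, the server estimate `g`, and for each worker
the momentum `v i` and the local estimate `gl i`. -/
structure State (n d : ℕ) where
  x : E d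
  g : E d
  v : Fin n → E d
  gl : Fin n → E d

/-- One iteration of Clip21-SGD2M without DP noise (momentum parameters `β` and `β'`, step size
`γ`, clipping level `τ`), with the fresh sample `s i` at worker `i`. -/
def step {n d : ℕ} {Ξ : Type*} (γ β β' τ : ℝ) (G : Fin n → E d → Ξ → E d) (s : Fin n → Ξ)
    (S : State n d) : State n d :=
  let x' : E d := S.x - γ • S.g
  let v' : Fin n → E d := fun i => (1 - β) • S.v i + β • G i x' (s i)
  let c : Fin n → E d := fun i => clip τ (v' i - S.gl i)
  { x := x'
    g := S.g + (β' / (n : ℝ)) • ∑ i, c i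
    v := v'
    gl := fun i => S.gl i + β' • c i }

/-- The run of Clip21-SGD2M without DP noise from `x⁰` with `g⁰ = v⁰ = 0`; iteration
`t → t + 1` uses the samples `s (t + 1) i`. -/
def run {n d : ℕ} {Ξ : Type*} (γ β β' τ : ℝ) (G : Fin n → E d → Ξ → E d) (x0 : E d)
    (s : ℕ → Fin n → Ξ) : ℕ → State n d
  | 0 => { x := x0, g := 0, v := fun _ => 0, gl := fun _ => 0 }
  | t + 1 => step γ β β' τ G (s (t + 1)) (run γ β β' τ G x0 s t)

/-- The quantity `(1/T) ∑_{t<T} ‖∇f(xᵗ)‖²` along the run with samples `s`. -/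
def avgSqGrad {n d : ℕ} {Ξ : Type*} (f : Fin n → E d → ℝ) (γ β β' τ : ℝ)
    (G : Fin n → E d → Ξ → E d) (x0 : E d) (s : ℕ → Fin n → Ξ) (T : ℕ) : ℝ :=
  (1 / (T : ℝ)) *
    ∑ t ∈ Finset.range T, ‖gradient (avgLoss f) (run γ β β' τ G x0 s t).x‖ ^ 2

/-- The two displayed terms of the rate. -/
def mainRate (n T : ℕ) (L Δ B τ σ : ℝ) : ℝ :=
  L * Δ * (1 + B / τ) / T + σ * (Real.sqrt (L * Δ) + B + σ) / Real.sqrt (n * T)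

/-- The remaining term, which decreases like `1 / T`, faster than `1 / √T`. -/
def higherOrder (T : ℕ) (L Δ τ σ : ℝ) : ℝ :=
  L * Δ * (Real.sqrt (L * Δ) + σ) / (τ * T)

end

end Clip21

namespace Clip21

/-! ### Smooth functions: the averaged loss, the descent lemma and inexact gradient steps. -/

section Smooth

variable {n d : ℕ}

/-! The momentum parameter `β` is taken so small that, with probability at least `1 - α`, no worker
ever clips. Without clipping the method is linear: averaged over the workers it is gradient descent
with a doubly averaged gradient estimate. The step size is tied to `β` by `γ = q² β / (108 L)`,
where `q` is the second momentum parameter.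

Deterministic part. The error of a momentum estimate `v` splits into the moving average `m` of the
noise and a bias that contracts by `1 - β` and is perturbed only by the drift of the gradient. The
drift per step is at most `L γ ‖g‖ = (q² / 108) β ‖g‖`, small enough to be absorbed by the `∑ ‖g‖²`
that the descent inequality leaves over; this is `sum_norm_sq_le_of_double_momentum`. Absence of
clipping follows by induction on time in `sum_norm_gradient_sq_le`. If nothing was clipped so far,
the energy estimate bounds `∑ ‖g‖²`, hence the drift of each local gradient, however heterogeneous
the losses are; only the gradients at `x0` enter, through `B`. So a local momentum moves by at most
`q τ` in the next step (`norm_v_succ_sub_v_le`), the last unclipped step left a residual of at most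
`(1 - q) τ` (`norm_gl_sub_v_le_of_noClip`), and the sum does not exceed `τ`.

Probabilistic part. The noise depends on the past through the iterate, and the bounds must not
depend on the dimension. `IsNormSubGaussian` is built for this: integrating out a fresh noise of
proxy `s` replaces the scale `h` by `h - s`, so proxies add along the run. Moving averages then have
proxy of order `σ² b ∑ wᵢ²` (`hasGaussianNorm_movingAvg`), which is `β σ² / n` for the mean over
workers. These bounds hold for the actual run, clipped or not, so the induction is not circular.

The averaged squared gradient is finally at most a multiple of `ι L Δ / (β T)`, with `ι` the
logarithm, and the summands of `1 / β` produce the terms of the rate (`rate_le`). -/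

theorem hasGradientAt_avgLoss {f : Fin n → E d → ℝ} (hf : ∀ i, Differentiable ℝ (f i)) (x : E d) :
    HasGradientAt (avgLoss f) ((1 / (n : ℝ)) • ∑ i, gradient (f i) x) x := by
  rw [hasGradientAt_iff_hasFDerivAt, map_smul, map_sum]
  have h : HasFDerivAt (fun y => ∑ i, f i y)
      (∑ i, InnerProductSpace.toDual ℝ (E d) (gradient (f i) x)) x :=
    HasFDerivAt.fun_sum fun i _ => (hf i x).hasGradientAt.hasFDerivAt
  exact h.const_mul _

theorem gradient_avgLoss {f : Fin n → E d → ℝ} (hf : ∀ i, Differentiable ℝ (f i)) (x : E d) :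
    gradient (avgLoss f) x = (1 / (n : ℝ)) • ∑ i, gradient (f i) x :=
  (hasGradientAt_avgLoss hf x).gradient

/-- The norm of an average is at most a common bound of the norms. -/
theorem norm_average_le {y : Fin n → E d} {c : ℝ} (hc : 0 ≤ c) (h : ∀ i, ‖y i‖ ≤ c) :
    ‖(1 / (n : ℝ)) • ∑ i, y i‖ ≤ c := by
  rw [norm_smul, Real.norm_of_nonneg (by positivity)]
  have h1 : ‖∑ i, y i‖ ≤ n * c := by
    refine (norm_sum_le _ _).trans ?_
    simpa using Finset.sum_le_sum (s := Finset.univ) fun i _ => h i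
  rcases Nat.eq_zero_or_pos n with hn | hn
  · simp [hn, hc]
  · calc 1 / (n : ℝ) * ‖∑ i, y i‖ ≤ 1 / (n : ℝ) * (n * c) := by gcongr
      _ = c := by field_simp

theorem SmoothProblem.norm_gradient_avgLoss_sub_le {L : ℝ} {f : Fin n → E d → ℝ} (hL : 0 ≤ L)
    (hf : SmoothProblem L f) (x y : E d) :
    ‖gradient (avgLoss f) x - gradient (avgLoss f) y‖ ≤ L * ‖x - y‖ := by
  rw [gradient_avgLoss hf.differentiable, gradient_avgLoss hf.differentiable, ← smul_sub,
    ← Finset.sum_sub_distrib]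
  exact norm_average_le (by positivity) fun i => hf.smooth i x y

theorem SmoothProblem.differentiable_avgLoss {L : ℝ} {f : Fin n → E d → ℝ}
    (hf : SmoothProblem L f) : Differentiable ℝ (avgLoss f) := fun x =>
  (hasGradientAt_avgLoss hf.differentiable x).differentiableAt

/-- The quadratic upper bound of a function with Lipschitz gradient. -/
theorem le_quadratic_of_lipschitz_gradient {F : Type*} [NormedAddCommGroup F]
    [InnerProductSpace ℝ F] [CompleteSpace F] {φ : F → ℝ} {L : ℝ}
    (hφ : Differentiable ℝ φ) (hL : ∀ x y, ‖gradient φ x - gradient φ y‖ ≤ L * ‖x - y‖) (x h : F) :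
    φ (x + h) ≤ φ x + inner ℝ (gradient φ x) h + L / 2 * ‖h‖ ^ 2 := by
  -- The claim is `ψ 1 ≤ ψ 0`; the Lipschitz bound makes the derivative of `ψ` nonpositive on `(0,
  -- 1)`.
  let ψ : ℝ → ℝ := fun s => φ (x + s • h) - s * inner ℝ (gradient φ x) h - L / 2 * ‖h‖ ^ 2 * s ^ 2
  have hd : ∀ s, HasDerivAt ψ (inner ℝ (gradient φ (x + s • h)) h - inner ℝ (gradient φ x) h
      - L / 2 * ‖h‖ ^ 2 * (2 * s)) s := by
    intro s
    have h1 : HasDerivAt (fun s : ℝ => x + s • h) h s := by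
      simpa using ((hasDerivAt_id s).smul_const h).const_add x
    have h2 := (hφ (x + s • h)).hasGradientAt.hasFDerivAt.comp_hasDerivAt s h1
    have h3 := (h2.sub ((hasDerivAt_id s).mul_const (inner ℝ (gradient φ x) h))).sub
      (((hasDerivAt_id s).pow 2).const_mul (L / 2 * ‖h‖ ^ 2))
    refine HasDerivAt.congr_deriv (f := ψ) h3 ?_
    simp
  have hanti : AntitoneOn ψ (Set.Icc 0 1) := by
    refine antitoneOn_of_deriv_nonpos (convex_Icc 0 1)
      (fun s _ => (hd s).continuousAt.continuousWithinAt)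
      (fun s _ => (hd s).differentiableAt.differentiableWithinAt) fun s hs => ?_
    rw [interior_Icc] at hs
    rw [(hd s).deriv, ← inner_sub_left]
    have h1 := real_inner_le_norm (gradient φ (x + s • h) - gradient φ x) h
    have h2 := hL (x + s • h) x
    rw [add_sub_cancel_left, norm_smul, Real.norm_of_nonneg hs.1.le] at h2
    have h3 := mul_le_mul_of_nonneg_right h2 (norm_nonneg h)
    nlinarith
  have := hanti (Set.left_mem_Icc.2 zero_le_one) (Set.right_mem_Icc.2 zero_le_one) zero_le_one
  simp only [ψ, one_smul, zero_smul, add_zero] at this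
  linarith

/-- A gradient step of length `1 / L` lowers `φ` by at least `‖∇φ‖² / (2L)`, and it cannot go below
the infimum. -/
theorem norm_gradient_sq_le_of_lipschitz_gradient {F : Type*} [NormedAddCommGroup F]
    [InnerProductSpace ℝ F] [CompleteSpace F] {φ : F → ℝ} {L : ℝ} (hLpos : 0 < L)
    (hφ : Differentiable ℝ φ) (hL : ∀ x y, ‖gradient φ x - gradient φ y‖ ≤ L * ‖x - y‖)
    (hb : BddBelow (Set.range φ)) (x : F) :
    ‖gradient φ x‖ ^ 2 ≤ 2 * L * (φ x - ⨅ y, φ y) := by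
  have h1 := le_quadratic_of_lipschitz_gradient hφ hL x (-(1 / L) • gradient φ x)
  have h2 := ciInf_le hb (x + (-(1 / L)) • gradient φ x)
  rw [real_inner_smul_right, real_inner_self_eq_norm_sq, norm_smul, mul_pow, Real.norm_eq_abs,
    sq_abs] at h1
  have h3 : ‖gradient φ x‖ ^ 2 / (2 * L) ≤ φ x - ⨅ y, φ y := by
    have : ‖gradient φ x‖ ^ 2 / (2 * L) = 1 / L * ‖gradient φ x‖ ^ 2
        - L / 2 * ((-(1 / L)) ^ 2 * ‖gradient φ x‖ ^ 2) := by field_simp; ring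
    linarith
  rw [div_le_iff₀ (by positivity)] at h3
  linarith

/-- One step of inexact gradient descent. -/
theorem inexact_descent {F : Type*} [NormedAddCommGroup F]
    [InnerProductSpace ℝ F] [CompleteSpace F] {φ : F → ℝ} {L γ : ℝ}
    (hφ : Differentiable ℝ φ) (hL : ∀ x y, ‖gradient φ x - gradient φ y‖ ≤ L * ‖x - y‖)
    (hγ : 0 ≤ γ) (hγL : L * γ ≤ 1 / 2) (x g : F) :
    φ (x - γ • g) + γ / 2 * ‖gradient φ x‖ ^ 2 + γ / 4 * ‖g‖ ^ 2
      ≤ φ x + γ / 2 * ‖g - gradient φ x‖ ^ 2 := by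
  have h1 := le_quadratic_of_lipschitz_gradient hφ hL x (-(γ • g))
  rw [← sub_eq_add_neg, inner_neg_right, real_inner_smul_right, norm_neg, norm_smul, mul_pow,
    Real.norm_of_nonneg hγ] at h1
  -- Polarization turns `-γ ⟨∇φ, g⟩` into the three squares; the curvature term uses up half of the
  -- resulting `-γ/2 ‖g‖²`.
  have h2 := norm_sub_sq_real g (gradient φ x)
  rw [real_inner_comm] at h2
  have h3 : L / 2 * (γ ^ 2 * ‖g‖ ^ 2) ≤ γ / 4 * ‖g‖ ^ 2 := by
    have : 0 ≤ γ * ‖g‖ ^ 2 := by positivity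
    nlinarith
  rw [h2]
  linarith

end Smooth

/-! ### Contracting recursions with perturbations. -/

section Recursion

/-- Sum and endpoint bound for a contracting recursion with perturbations. -/
theorem sum_add_le_of_contraction {a c : ℕ → ℝ} {q : ℝ} {K : ℕ}
    (h : ∀ t < K, a (t + 1) ≤ (1 - q) * a t + c t) :
    q * ∑ t ∈ Finset.range K, a t + a K ≤ a 0 + ∑ t ∈ Finset.range K, c t := by
  induction K with
  | zero => simp
  | succ K ih =>
    have h1 := ih fun t ht => h t (by omega)
    have h2 := h K (by omega)
    rw [Finset.sum_range_succ, Finset.sum_range_succ]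
    linarith

/-- Weighted Young inequality, by completing a square: one factor `1 - q` survives as the
contraction rate, and the perturbation costs `1 / q`. -/
theorem norm_smul_add_sq_le {F : Type*} [NormedAddCommGroup F] [InnerProductSpace ℝ F] {q : ℝ}
    (hq : 0 < q) (hq1 : q ≤ 1) (y z : F) :
    ‖(1 - q) • (y + z)‖ ^ 2 ≤ (1 - q) * ‖y‖ ^ 2 + ‖z‖ ^ 2 / q := by
  have hyz : ‖y + z‖ ≤ ‖y‖ + ‖z‖ := norm_add_le _ _
  rw [norm_smul, Real.norm_of_nonneg (by linarith), mul_pow]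
  have h1 : ‖y + z‖ ^ 2 ≤ (‖y‖ + ‖z‖) ^ 2 := by gcongr
  have h2 : (1 - q) * (‖y‖ + ‖z‖) ^ 2 ≤ ‖y‖ ^ 2 + ‖z‖ ^ 2 / q := by
    have e : ‖y‖ ^ 2 + ‖z‖ ^ 2 / q - (1 - q) * (‖y‖ + ‖z‖) ^ 2
        = (q * ‖y‖ - (1 - q) * ‖z‖) ^ 2 / q + ‖z‖ ^ 2 := by
      field_simp
      ring
    have : 0 ≤ (q * ‖y‖ - (1 - q) * ‖z‖) ^ 2 / q + ‖z‖ ^ 2 := by positivity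
    linarith
  have hz : 0 ≤ ‖z‖ ^ 2 / q := by positivity
  have hp : 0 ≤ 1 - q := by linarith
  calc (1 - q) ^ 2 * ‖y + z‖ ^ 2 = (1 - q) * ((1 - q) * ‖y + z‖ ^ 2) := by ring
    _ ≤ (1 - q) * (‖y‖ ^ 2 + ‖z‖ ^ 2 / q) := by
        refine mul_le_mul_of_nonneg_left (le_trans ?_ h2) hp
        exact mul_le_mul_of_nonneg_left h1 hp
    _ ≤ (1 - q) * ‖y‖ ^ 2 + ‖z‖ ^ 2 / q := by nlinarith

end Recursion

/-! ### Dimension-free exponential moments of squared norms. -/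

section SubGaussian

variable {F : Type*} [NormedAddCommGroup F]

/-- `ofReal (exp y)`, the exponential as a nonnegative extended real. -/
noncomputable def eexp (y : ℝ) : ENNReal := ENNReal.ofReal (Real.exp y)

theorem eexp_mono {a b : ℝ} (h : a ≤ b) : eexp a ≤ eexp b :=
  ENNReal.ofReal_le_ofReal (Real.exp_le_exp.2 h)

theorem eexp_add (a b : ℝ) : eexp (a + b) = eexp a * eexp b := by
  rw [eexp, Real.exp_add, ENNReal.ofReal_mul (Real.exp_pos _).le]; rfl

theorem eexp_zero : eexp 0 = 1 := by simp [eexp]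

theorem eexp_ne_top (a : ℝ) : eexp a ≠ ⊤ := ENNReal.ofReal_ne_top

theorem eexp_rpow (a p : ℝ) : eexp a ^ p = eexp (a * p) := by
  rw [eexp, ENNReal.ofReal_rpow_of_pos (Real.exp_pos _), ← Real.exp_mul]; rfl

@[fun_prop]
theorem measurable_eexp : Measurable eexp := by
  unfold eexp; fun_prop

/-- A quantitative sub-Gaussian property of a random vector `X` that is additive under
independent sums: Gaussian vectors satisfy it, with variance proxy `s`. -/
def IsNormSubGaussian {Ω : Type*} [MeasurableSpace Ω] (μ : Measure Ω) (s : ℝ) (X : Ω → F) : Prop :=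
  ∀ (S : F) (h : ℝ), s < h → ∫⁻ ω, eexp (‖S + X ω‖ ^ 2 / h) ∂μ ≤ eexp ((‖S‖ ^ 2 + s) / (h - s))

/-- Jensen's inequality for the concave power `p ≤ 1`, obtained from Hölder against the constant
`1`. -/
theorem lintegral_eexp_mul_le {Ω : Type*} [MeasurableSpace Ω] {μ : Measure Ω}
    [IsProbabilityMeasure μ] {φ : Ω → ℝ} (hφ : Measurable φ)
    (h : ∫⁻ ω, eexp (φ ω) ∂μ ≤ eexp 1) {p : ℝ} (hp : 0 ≤ p) (hp1 : p ≤ 1) :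
    ∫⁻ ω, eexp (p * φ ω) ∂μ ≤ eexp p := by
  have h1 := ENNReal.lintegral_mul_norm_pow_le (μ := μ) (f := fun ω => eexp (φ ω))
    (g := fun _ => 1) (p := p) (q := 1 - p) (by fun_prop) (by fun_prop) hp (by linarith) (by ring)
  simp only [ENNReal.one_rpow, mul_one, lintegral_const, measure_univ] at h1
  calc ∫⁻ ω, eexp (p * φ ω) ∂μ = ∫⁻ ω, eexp (φ ω) ^ p ∂μ := by
        simp only [eexp_rpow, mul_comm]
    _ ≤ (∫⁻ ω, eexp (φ ω) ∂μ) ^ p := h1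
    _ ≤ eexp 1 ^ p := ENNReal.rpow_le_rpow h hp
    _ = eexp p := by rw [eexp_rpow, one_mul]

/-- The linear term vanishes in expectation for a centred variable, which leaves only the
exponential of a square. -/
theorem exp_le_add_exp_sq (y : ℝ) : Real.exp y ≤ y + Real.exp (y ^ 2) := by
  have h1 := Real.add_one_le_exp (y ^ 2)
  rcases le_total |y| 1 with hy | hy
  · have h2 := (abs_le.1 (Real.abs_exp_sub_one_sub_id_le hy)).2
    linarith
  · rcases le_abs'.1 hy with hy | hy
    · have h2 : Real.exp y ≤ 1 := Real.exp_le_one_iff.2 (by linarith)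
      nlinarith
    · have h2 : Real.exp y ≤ Real.exp (y ^ 2) := Real.exp_le_exp.2 (by nlinarith)
      linarith

section Inner

variable [InnerProductSpace ℝ F]

/-- Moment generating function of a centred random vector with sub-Gaussian norm. -/
theorem lintegral_eexp_inner_le {Ω : Type*} [MeasurableSpace Ω] [MeasurableSpace F] [BorelSpace F]
    [SecondCountableTopology F] [CompleteSpace F]
    {μ : Measure Ω}
    [IsProbabilityMeasure μ] {X : Ω → F} (hX : Measurable X) (hint : Integrable X μ)
    (hmean : ∫ ω, X ω ∂μ = 0) {σ : ℝ} (hσ : 0 < σ)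
    (h : ∫⁻ ω, eexp (‖X ω‖ ^ 2 / σ ^ 2) ∂μ ≤ eexp 1) (u : F) :
    ∫⁻ ω, eexp (inner ℝ u (X ω)) ∂μ ≤ eexp (‖u‖ ^ 2 * σ ^ 2) := by
  have hφ : Measurable fun ω => ‖X ω‖ ^ 2 / σ ^ 2 := by fun_prop
  -- For small `u` centring is essential and `exp_le_add_exp_sq` applies. For large `u` Young's
  -- inequality suffices, since the leftover `1 / 2` is at most `‖u‖² σ² / 2`.
  rcases le_total (‖u‖ ^ 2 * σ ^ 2) 1 with hA | hA
  · have h1 := lintegral_eexp_mul_le hφ h (p := ‖u‖ ^ 2 * σ ^ 2) (by positivity) hA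
    have hsq : ∀ ω, (inner ℝ u (X ω)) ^ 2 ≤ ‖u‖ ^ 2 * σ ^ 2 * (‖X ω‖ ^ 2 / σ ^ 2) := fun ω => by
      have e : ‖u‖ ^ 2 * σ ^ 2 * (‖X ω‖ ^ 2 / σ ^ 2) = (‖u‖ * ‖X ω‖) ^ 2 := by
        field_simp
      rw [e]
      exact sq_le_sq' (by linarith [(abs_le.1 (abs_real_inner_le_norm u (X ω))).1])
        (real_inner_le_norm _ _)
    set ψ : Ω → ℝ := fun ω => Real.exp (‖u‖ ^ 2 * σ ^ 2 * (‖X ω‖ ^ 2 / σ ^ 2)) with hψ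
    have hψm : Measurable ψ := by fun_prop
    have hψint : Integrable ψ μ := by
      refine ⟨hψm.aestronglyMeasurable, ?_⟩
      rw [hasFiniteIntegral_iff_ofReal (Filter.Eventually.of_forall fun ω => (Real.exp_pos _).le)]
      exact lt_of_le_of_lt h1 (eexp_ne_top _).lt_top
    have hin : Integrable (fun ω => inner ℝ u (X ω)) μ := hint.const_inner u
    have hle : ∀ ω, Real.exp (inner ℝ u (X ω)) ≤ inner ℝ u (X ω) + ψ ω := fun ω =>
      (exp_le_add_exp_sq _).trans (by simpa [hψ] using hsq ω)
    have hexp : Integrable (fun ω => Real.exp (inner ℝ u (X ω))) μ := by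
      refine (hin.add hψint).mono' (by fun_prop) (Filter.Eventually.of_forall fun ω => ?_)
      rw [Real.norm_of_nonneg (Real.exp_pos _).le]
      exact hle ω
    have hI : ∫ ω, Real.exp (inner ℝ u (X ω)) ∂μ ≤ ∫ ω, ψ ω ∂μ := by
      have h2 : ∫ ω, Real.exp (inner ℝ u (X ω)) ∂μ ≤ ∫ ω, (inner ℝ u (X ω) + ψ ω) ∂μ :=
        integral_mono hexp (hin.add hψint) hle
      rw [integral_add hin hψint, integral_inner hint, hmean, inner_zero_right, zero_add] at h2
      exact h2
    calc ∫⁻ ω, eexp (inner ℝ u (X ω)) ∂μ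
        = ENNReal.ofReal (∫ ω, Real.exp (inner ℝ u (X ω)) ∂μ) :=
          (ofReal_integral_eq_lintegral_ofReal hexp
            (Filter.Eventually.of_forall fun ω => (Real.exp_pos _).le)).symm
      _ ≤ ENNReal.ofReal (∫ ω, ψ ω ∂μ) := ENNReal.ofReal_le_ofReal hI
      _ = ∫⁻ ω, ENNReal.ofReal (ψ ω) ∂μ := ofReal_integral_eq_lintegral_ofReal hψint
            (Filter.Eventually.of_forall fun ω => (Real.exp_pos _).le)
      _ ≤ _ := h1
  · have h1 := lintegral_eexp_mul_le hφ h (p := 1 / 2) (by norm_num) (by norm_num)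
    have hle : ∀ ω, inner ℝ u (X ω) ≤ ‖u‖ ^ 2 * σ ^ 2 / 2 + 1 / 2 * (‖X ω‖ ^ 2 / σ ^ 2) := fun ω => by
      refine (real_inner_le_norm _ _).trans ?_
      have e : ‖u‖ ^ 2 * σ ^ 2 / 2 + 1 / 2 * (‖X ω‖ ^ 2 / σ ^ 2)
          = ‖u‖ * ‖X ω‖ + (‖u‖ * σ - ‖X ω‖ / σ) ^ 2 / 2 := by
        field_simp
        ring
      rw [e]
      have : 0 ≤ (‖u‖ * σ - ‖X ω‖ / σ) ^ 2 / 2 := by positivity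
      linarith
    calc ∫⁻ ω, eexp (inner ℝ u (X ω)) ∂μ
        ≤ ∫⁻ ω, eexp (‖u‖ ^ 2 * σ ^ 2 / 2) * eexp (1 / 2 * (‖X ω‖ ^ 2 / σ ^ 2)) ∂μ := by
          refine lintegral_mono fun ω => ?_
          rw [← eexp_add]
          exact eexp_mono (hle ω)
      _ = eexp (‖u‖ ^ 2 * σ ^ 2 / 2) * ∫⁻ ω, eexp (1 / 2 * (‖X ω‖ ^ 2 / σ ^ 2)) ∂μ :=
          lintegral_const_mul _ (by fun_prop)
      _ ≤ eexp (‖u‖ ^ 2 * σ ^ 2 / 2) * eexp (1 / 2) := by gcongr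
      _ ≤ eexp (‖u‖ ^ 2 * σ ^ 2) := by
          rw [← eexp_add]
          exact eexp_mono (by linarith)

/-- The left side consists of leading terms of the expansion of `(a + s) / (h - s)` in powers of `s
/ h`. -/
theorem inv_sub_bound {a s h : ℝ} (ha : 0 ≤ a) (hs : 0 ≤ s) (hh : s < h) :
    a / h + a * s / h ^ 2 + s / h ≤ (a + s) / (h - s) := by
  have h0 : 0 < h := by linarith
  have h1 : 0 < h - s := by linarith
  rw [le_div_iff₀ h1]
  have e : (a / h + a * s / h ^ 2 + s / h) * (h - s)
      = a + s - a * s ^ 2 / h ^ 2 - s ^ 2 / h := by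
    field_simp
    ring
  have : 0 ≤ a * s ^ 2 / h ^ 2 := by positivity
  have : 0 ≤ s ^ 2 / h := by positivity
  linarith

/-- A centred vector whose norm is `σ`-sub-Gaussian satisfies `IsNormSubGaussian`. -/
theorem isNormSubGaussian_of_lintegral_le {Ω : Type*} [MeasurableSpace Ω] [MeasurableSpace F]
    [BorelSpace F] [SecondCountableTopology F] [CompleteSpace F] {μ : Measure Ω}
    [IsProbabilityMeasure μ] {X : Ω → F} (hX : Measurable X) (hint : Integrable X μ)
    (hmean : ∫ ω, X ω ∂μ = 0) {σ : ℝ} (hσ : 0 ≤ σ)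
    (h : ∫⁻ ω, eexp (‖X ω‖ ^ 2 / σ ^ 2) ∂μ ≤ eexp 1) (h0 : σ = 0 → ∀ᵐ ω ∂μ, X ω = 0) :
    IsNormSubGaussian μ (8 * σ ^ 2) X := by
  intro S k hk
  have hk0 : 0 < k := by nlinarith [sq_nonneg σ]
  rcases hσ.eq_or_lt with hσ0 | hσ0
  · have h1 : ∫⁻ ω, eexp (‖S + X ω‖ ^ 2 / k) ∂μ = ∫⁻ _, eexp (‖S‖ ^ 2 / k) ∂μ := by
      refine lintegral_congr_ae ?_
      filter_upwards [h0 hσ0.symm] with ω hω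
      rw [hω, add_zero]
    rw [h1, ← hσ0]
    simp
  · have hmgf := lintegral_eexp_inner_le hX hint hmean hσ0 h ((4 / k) • S)
    have hφ : Measurable fun ω => ‖X ω‖ ^ 2 / σ ^ 2 := by fun_prop
    have hsq := lintegral_eexp_mul_le hφ h (p := 2 * σ ^ 2 / k) (by positivity)
      (by rw [div_le_one hk0]; nlinarith)
    -- Cauchy–Schwarz separates the cross term of `‖S + X‖²` from `‖X‖²`. Doubling its exponent
    -- gives the vector `(4 / k) • S`, whose moment bound `16 ‖S‖² σ² / k²` is halved by the square
    -- root: hence the proxy `8 σ²`.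
    have hCS := ENNReal.lintegral_mul_norm_pow_le (μ := μ)
      (f := fun ω => eexp (inner ℝ ((4 / k) • S) (X ω)))
      (g := fun ω => eexp (2 * σ ^ 2 / k * (‖X ω‖ ^ 2 / σ ^ 2))) (p := 1 / 2) (q := 1 / 2)
      (by fun_prop) (by fun_prop) (by norm_num) (by norm_num) (by norm_num)
    have hpt : ∀ ω, eexp (‖S + X ω‖ ^ 2 / k) = eexp (‖S‖ ^ 2 / k) *
        (eexp (inner ℝ ((4 / k) • S) (X ω)) ^ (1 / 2 : ℝ) *
          eexp (2 * σ ^ 2 / k * (‖X ω‖ ^ 2 / σ ^ 2)) ^ (1 / 2 : ℝ)) := fun ω => by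
      rw [eexp_rpow, eexp_rpow, ← eexp_add, ← eexp_add, norm_add_sq_real, real_inner_smul_left]
      congr 1
      field_simp
      ring
    simp only [hpt]
    rw [lintegral_const_mul _ (by fun_prop)]
    calc _ ≤ eexp (‖S‖ ^ 2 / k) * (eexp (‖(4 / k) • S‖ ^ 2 * σ ^ 2) ^ (1 / 2 : ℝ) *
          eexp (2 * σ ^ 2 / k) ^ (1 / 2 : ℝ)) := by
          gcongr
          refine hCS.trans ?_
          gcongr
      _ = eexp (‖S‖ ^ 2 / k + (‖(4 / k) • S‖ ^ 2 * σ ^ 2 * (1 / 2) + 2 * σ ^ 2 / k * (1 / 2))) := by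
          rw [eexp_rpow, eexp_rpow, ← eexp_add, ← eexp_add]
      _ ≤ _ := by
          refine eexp_mono (le_trans ?_ (inv_sub_bound (sq_nonneg ‖S‖) (by positivity) hk))
          rw [norm_smul, Real.norm_of_nonneg (by positivity)]
          have e1 : (4 / k * ‖S‖) ^ 2 * σ ^ 2 * (1 / 2) = ‖S‖ ^ 2 * (8 * σ ^ 2) / k ^ 2 := by
            field_simp
            ring
          have e2 : 2 * σ ^ 2 / k * (1 / 2) ≤ 8 * σ ^ 2 / k := by
            rw [div_mul_eq_mul_div]
            exact div_le_div_of_nonneg_right (by nlinarith [sq_nonneg σ]) hk0.le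
          rw [e1]
          linarith

theorem IsNormSubGaussian.smul {Ω : Type*} [MeasurableSpace Ω] {μ : Measure Ω}
    [IsProbabilityMeasure μ] {X : Ω → F} {s : ℝ} (hX : IsNormSubGaussian μ s X) (a : ℝ) :
    IsNormSubGaussian μ (a ^ 2 * s) (fun ω => a • X ω) := by
  intro S h hh
  rcases eq_or_ne a 0 with rfl | ha
  · simp
  have ha2 : 0 < a ^ 2 := by positivity
  have h1 := hX (a⁻¹ • S) (h / a ^ 2) (by rw [lt_div_iff₀ ha2]; linarith)
  have e1 : ∀ ω, ‖a⁻¹ • S + X ω‖ ^ 2 / (h / a ^ 2) = ‖S + a • X ω‖ ^ 2 / h := fun ω => by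
    have : S + a • X ω = a • (a⁻¹ • S + X ω) := by rw [smul_add, smul_inv_smul₀ ha]
    rw [this, norm_smul, mul_pow, Real.norm_eq_abs, sq_abs]
    field_simp
  have e2 : (‖a⁻¹ • S‖ ^ 2 + s) / (h / a ^ 2 - s) = (‖S‖ ^ 2 + a ^ 2 * s) / (h - a ^ 2 * s) := by
    rw [norm_smul, mul_pow, Real.norm_eq_abs, sq_abs]
    have : h - a ^ 2 * s ≠ 0 := by linarith
    have : h / a ^ 2 - s ≠ 0 := by
      have : s < h / a ^ 2 := by rw [lt_div_iff₀ ha2]; linarith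
      linarith
    rw [div_eq_div_iff ‹_› ‹_›]
    field_simp
  simpa only [e1, e2] using h1

end Inner

/-- Averaging out a fresh sample: the vector `S (H ω) + X (H ω) (Z ω)`, with `Z` independent of
the history `H` and each `X y` sub-Gaussian under the law of `Z`. -/
theorem lintegral_eexp_add_le_of_indepFun {Ω Y Z : Type*} [MeasurableSpace Ω] [MeasurableSpace Y]
    [MeasurableSpace Z] [MeasurableSpace F] [BorelSpace F] [SecondCountableTopology F]
    {P : Measure Ω} [IsProbabilityMeasure P] {H : Ω → Y} {ζ : Ω → Z} (hH : Measurable H)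
    (hζ : Measurable ζ) (hind : IndepFun H ζ P) {S : Y → F} (hS : Measurable S) {X : Y → Z → F}
    (hX : Measurable (fun p : Y × Z => X p.1 p.2)) {s : ℝ}
    (hsub : ∀ y, IsNormSubGaussian (P.map ζ) s (X y)) {h : ℝ} (hh : s < h) :
    ∫⁻ ω, eexp (‖S (H ω) + X (H ω) (ζ ω)‖ ^ 2 / h) ∂P
      ≤ ∫⁻ ω, eexp ((‖S (H ω)‖ ^ 2 + s) / (h - s)) ∂P := by
  have := Measure.isProbabilityMeasure_map (μ := P) hζ.aemeasurable
  have hm : Measurable fun p : Y × Z => eexp (‖S p.1 + X p.1 p.2‖ ^ 2 / h) := by fun_prop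
  calc ∫⁻ ω, eexp (‖S (H ω) + X (H ω) (ζ ω)‖ ^ 2 / h) ∂P
      = ∫⁻ p, eexp (‖S p.1 + X p.1 p.2‖ ^ 2 / h) ∂(P.map fun ω => (H ω, ζ ω)) :=
        (lintegral_map hm (hH.prodMk hζ)).symm
    _ = ∫⁻ y, ∫⁻ z, eexp (‖S y + X y z‖ ^ 2 / h) ∂(P.map ζ) ∂(P.map H) := by
        rw [(indepFun_iff_map_prod_eq_prod_map_map hH.aemeasurable hζ.aemeasurable).1 hind,
          lintegral_prod _ hm.aemeasurable]
    _ ≤ ∫⁻ y, eexp ((‖S y‖ ^ 2 + s) / (h - s)) ∂(P.map H) :=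
        lintegral_mono fun y => hsub y (S y) h hh
    _ = ∫⁻ ω, eexp ((‖S (H ω)‖ ^ 2 + s) / (h - s)) ∂P := lintegral_map (by fun_prop) hH

theorem div_sub_add_div_sub_le {a s r h : ℝ} (hs : 0 ≤ s) (hr : 0 ≤ r) (hh : s + r < h) :
    s / (h - s) + (a ^ 2 + r) / (h - s - r) ≤ (a ^ 2 + (s + r)) / (h - (s + r)) := by
  have h1 : 0 < h - (s + r) := by linarith
  have h2 : s / (h - s) ≤ s / (h - (s + r)) :=
    div_le_div_of_nonneg_left hs h1 (by linarith)
  calc s / (h - s) + (a ^ 2 + r) / (h - s - r)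
      ≤ s / (h - (s + r)) + (a ^ 2 + r) / (h - (s + r)) := by rw [sub_sub]; gcongr
    _ = _ := by rw [← add_div]; ring

/-- Conditionally on `Y`, integrating `X` out costs `exp (s / (h - s))` and leaves the scale `h -
s`, at which the bound for `Y` applies. -/
theorem IsNormSubGaussian.add {Ω : Type*} [MeasurableSpace Ω] [MeasurableSpace F] [BorelSpace F]
    [SecondCountableTopology F] {P : Measure Ω} [IsProbabilityMeasure P] {X Y : Ω → F} {s r : ℝ}
    (hs : 0 ≤ s) (hr : 0 ≤ r) (hXm : Measurable X) (hYm : Measurable Y)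
    (hX : IsNormSubGaussian P s X) (hY : IsNormSubGaussian P r Y) (hind : IndepFun Y X P) :
    IsNormSubGaussian P (s + r) (fun ω => X ω + Y ω) := by
  intro S h hh
  have hX' : IsNormSubGaussian (P.map X) s (fun x => x) := fun S h hh => by
    rw [lintegral_map (by fun_prop) hXm]
    exact hX S h hh
  have h1 := lintegral_eexp_add_le_of_indepFun hYm hXm hind (S := fun y => S + y)
    (X := fun _ x => x) (by fun_prop) (by fun_prop) (fun _ => hX') (h := h) (by linarith)
  calc ∫⁻ ω, eexp (‖S + (X ω + Y ω)‖ ^ 2 / h) ∂P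
      = ∫⁻ ω, eexp (‖S + Y ω + X ω‖ ^ 2 / h) ∂P := by
        simp only [add_assoc, add_comm (X _)]
    _ ≤ ∫⁻ ω, eexp (s / (h - s)) * eexp (‖S + Y ω‖ ^ 2 / (h - s)) ∂P := by
        refine h1.trans (lintegral_mono fun ω => ?_)
        rw [← eexp_add, ← add_div, add_comm]
    _ = eexp (s / (h - s)) * ∫⁻ ω, eexp (‖S + Y ω‖ ^ 2 / (h - s)) ∂P :=
        lintegral_const_mul _ (by fun_prop)
    _ ≤ eexp (s / (h - s)) * eexp ((‖S‖ ^ 2 + r) / (h - s - r)) := by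
        gcongr
        exact hY S (h - s) (by linarith)
    _ ≤ _ := by
        rw [← eexp_add]
        exact eexp_mono (div_sub_add_div_sub_le hs hr hh)

theorem IsNormSubGaussian.sum {Ω ι : Type*} [MeasurableSpace Ω] [MeasurableSpace F] [BorelSpace F]
    [SecondCountableTopology F] {P : Measure Ω} [IsProbabilityMeasure P] {X : ι → Ω → F} {s : ι → ℝ}
    (hs : ∀ i, 0 ≤ s i) (hXm : ∀ i, Measurable (X i)) (hX : ∀ i, IsNormSubGaussian P (s i) (X i))
    (hind : iIndepFun X P) (I : Finset ι) :
    IsNormSubGaussian P (∑ i ∈ I, s i) (fun ω => ∑ i ∈ I, X i ω) := by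
  classical
  induction I using Finset.induction_on with
  | empty => intro S h hh; simp
  | insert i I hi ih =>
    simp only [Finset.sum_insert hi]
    have h1 := hind.indepFun_finsetSum_of_notMem hXm hi
    refine IsNormSubGaussian.add (hs i) (Finset.sum_nonneg fun j _ => hs j) (hXm i)
      (by fun_prop) (hX i) ih ?_
    convert h1 using 1
    ext ω
    simp

/-- The exponential moments of the squared norm of `X` are bounded as for a centred
`IsNormSubGaussian` vector. -/
def HasGaussianNorm {Ω : Type*} [MeasurableSpace Ω] (P : Measure Ω) (s : ℝ) (X : Ω → F) : Prop :=
  ∀ h, s < h → ∫⁻ ω, eexp (‖X ω‖ ^ 2 / h) ∂P ≤ eexp (s / (h - s))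

theorem HasGaussianNorm.mono {Ω : Type*} [MeasurableSpace Ω] {P : Measure Ω} {X : Ω → F} {s r : ℝ}
    (hs : 0 ≤ s) (hsr : s ≤ r) (hX : HasGaussianNorm P s X) : HasGaussianNorm P r X := by
  intro h hh
  refine (hX h (by linarith)).trans (eexp_mono ?_)
  have : 0 < h - r := by linarith
  gcongr
  exact hs.trans hsr

theorem HasGaussianNorm.smul [NormedSpace ℝ F] {Ω : Type*} [MeasurableSpace Ω] {P : Measure Ω}
    [IsProbabilityMeasure P] {X : Ω → F} {s : ℝ} (hX : HasGaussianNorm P s X) (a : ℝ) :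
    HasGaussianNorm P (a ^ 2 * s) (fun ω => a • X ω) := by
  intro h hh
  rcases eq_or_ne a 0 with rfl | ha
  · simp
  have ha2 : 0 < a ^ 2 := by positivity
  have hlt : s < h / a ^ 2 := by rw [lt_div_iff₀ ha2]; linarith
  have e1 : ∀ ω, ‖a • X ω‖ ^ 2 / h = ‖X ω‖ ^ 2 / (h / a ^ 2) := fun ω => by
    rw [norm_smul, mul_pow, Real.norm_eq_abs, sq_abs]
    field_simp
  have e2 : s / (h / a ^ 2 - s) = a ^ 2 * s / (h - a ^ 2 * s) := by
    rw [div_eq_div_iff (by linarith) (by linarith)]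
    field_simp
  simpa only [e1, e2] using hX _ hlt

/-- Adding a fresh conditionally sub-Gaussian vector to a vector determined by the history. -/
theorem HasGaussianNorm.add_of_indepFun {Ω Y Z : Type*} [MeasurableSpace Ω] [MeasurableSpace Y]
    [MeasurableSpace Z] [MeasurableSpace F] [BorelSpace F] [SecondCountableTopology F]
    {P : Measure Ω} [IsProbabilityMeasure P] {H : Ω → Y} {ζ : Ω → Z} (hH : Measurable H)
    (hζ : Measurable ζ) (hind : IndepFun H ζ P) {S : Y → F} (hS : Measurable S) {X : Y → Z → F}
    (hX : Measurable (fun p : Y × Z => X p.1 p.2)) {s r : ℝ} (hs : 0 ≤ s) (hr : 0 ≤ r)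
    (hsub : ∀ y, IsNormSubGaussian (P.map ζ) s (X y)) (hS' : HasGaussianNorm P r (fun ω => S (H ω))) :
    HasGaussianNorm P (s + r) (fun ω => S (H ω) + X (H ω) (ζ ω)) := by
  intro h hh
  calc ∫⁻ ω, eexp (‖S (H ω) + X (H ω) (ζ ω)‖ ^ 2 / h) ∂P
      ≤ ∫⁻ ω, eexp ((‖S (H ω)‖ ^ 2 + s) / (h - s)) ∂P :=
        lintegral_eexp_add_le_of_indepFun hH hζ hind hS hX hsub (by linarith)
    _ = ∫⁻ ω, eexp (s / (h - s)) * eexp (‖S (H ω)‖ ^ 2 / (h - s)) ∂P := by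
        simp only [← eexp_add, ← add_div, add_comm]
    _ = eexp (s / (h - s)) * ∫⁻ ω, eexp (‖S (H ω)‖ ^ 2 / (h - s)) ∂P :=
        lintegral_const_mul _ (by fun_prop)
    _ ≤ eexp (s / (h - s)) * eexp (r / (h - s - r)) := by
        gcongr
        exact hS' (h - s) (by linarith)
    _ ≤ _ := by
        rw [← eexp_add]
        exact eexp_mono (by simpa using div_sub_add_div_sub_le (a := 0) hs hr hh)

/-- Tail bound for the norm. -/
theorem HasGaussianNorm.measure_norm_sq_gt_le {Ω : Type*} [MeasurableSpace Ω] [MeasurableSpace F]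
    [OpensMeasurableSpace F] {P : Measure Ω} [IsProbabilityMeasure P] {X : Ω → F}
    (hXm : Measurable X) {s : ℝ} (hs : 0 ≤ s)
    (hX : HasGaussianNorm P s X) (r : ℝ) :
    P {ω | 2 * s * r < ‖X ω‖ ^ 2} ≤ eexp (1 - r) := by
  rcases hs.eq_or_lt with rfl | hs
  -- With proxy zero, `1 + y ≤ exp y` forces `X` to vanish almost surely.
  · have h1 : ∫⁻ ω, eexp (‖X ω‖ ^ 2) ∂P ≤ 1 := by
      simpa only [div_one, zero_div, eexp_zero] using hX 1 one_pos
    have h2 : ∫⁻ ω, (ENNReal.ofReal (‖X ω‖ ^ 2) + 1) ∂P ≤ 1 := by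
      refine le_trans (lintegral_mono fun ω => ?_) h1
      rw [← ENNReal.ofReal_one, ← ENNReal.ofReal_add (by positivity) zero_le_one]
      exact ENNReal.ofReal_le_ofReal (Real.add_one_le_exp _)
    have h3 : ∫⁻ ω, ENNReal.ofReal (‖X ω‖ ^ 2) ∂P = 0 := by
      rw [lintegral_add_right _ measurable_const] at h2
      simp only [lintegral_const, measure_univ, mul_one] at h2
      simpa using (ENNReal.add_le_add_iff_right ENNReal.one_ne_top).1 (h2.trans_eq (zero_add 1).symm)
    rw [lintegral_eq_zero_iff (by fun_prop)] at h3
    have h4 : P {ω | 2 * 0 * r < ‖X ω‖ ^ 2} = 0 := by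
      refine measure_mono_null (fun ω hω => ?_) h3
      have h5 : 0 < ‖X ω‖ ^ 2 := by simpa using hω
      have h6 : X ω ≠ 0 := fun hx => by simp [hx] at h5
      simpa using h6
    rw [h4]
    exact zero_le
  -- Markov's inequality at the scale `h = 2 s`, where the exponential moment is at most `e`.
  · have h1 := hX (2 * s) (by linarith)
    have e : s / (2 * s - s) = 1 := by field_simp; ring
    rw [e] at h1
    have h2 := mul_meas_ge_le_lintegral (μ := P) (f := fun ω => eexp (‖X ω‖ ^ 2 / (2 * s)))
      (by fun_prop) (eexp r)
    calc P {ω | 2 * s * r < ‖X ω‖ ^ 2}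
        ≤ P {ω | eexp r ≤ eexp (‖X ω‖ ^ 2 / (2 * s))} := by
          refine measure_mono fun ω hω => eexp_mono ?_
          rw [le_div_iff₀ (by positivity)]
          have : 2 * s * r < ‖X ω‖ ^ 2 := hω
          linarith
      _ = eexp (-r) * (eexp r * P {ω | eexp r ≤ eexp (‖X ω‖ ^ 2 / (2 * s))}) := by
          rw [← mul_assoc, ← eexp_add, neg_add_cancel, eexp_zero, one_mul]
      _ ≤ eexp (-r) * eexp 1 := by gcongr; exact h2.trans h1
      _ = eexp (1 - r) := by rw [← eexp_add]; congr 1; ring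

end SubGaussian

/-! ### Measurability and independence along the run; tails of the averaged noise. -/

section Noise

variable {n d : ℕ} {Ξ Ω : Type*}

/-- The noise `∇fᵢ(xᵗ, ξᵢᵗ) - ∇fᵢ(xᵗ)` along the run with samples `s`. -/
noncomputable def noise (f : Fin n → E d → ℝ) (γ β β' τ : ℝ) (G : Fin n → E d → Ξ → E d) (x0 : E d)
    (s : ℕ → Fin n → Ξ) (t : ℕ) (i : Fin n) : E d :=
  G i (run γ β β' τ G x0 s t).x (s t i) - gradient (f i) (run γ β β' τ G x0 s t).x

/-- Exponential moving average, with parameter `b`, of the weighted sums `∑ᵢ wᵢ εᵢᵗ`. -/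
noncomputable def movingAvg (b : ℝ) (w : Fin n → ℝ) (ε : ℕ → Fin n → E d) : ℕ → E d
  | 0 => 0
  | t + 1 => (1 - b) • movingAvg b w ε t + b • ∑ i, w i • ε (t + 1) i

/-- The measurability of all components of a random state. -/
structure MeasurableState [MeasurableSpace Ω] (S : Ω → State n d) : Prop where
  x : Measurable fun ω => (S ω).x
  g : Measurable fun ω => (S ω).g
  v : ∀ i, Measurable fun ω => (S ω).v i
  gl : ∀ i, Measurable fun ω => (S ω).gl i

theorem measurable_fun_const_smul {m : MeasurableSpace Ω} {φ : Ω → E d} (hφ : Measurable φ)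
    (c : ℝ) : Measurable fun ω => c • φ ω := hφ.const_smul c

theorem measurable_fun_add {m : MeasurableSpace Ω} {φ ψ : Ω → E d} (hφ : Measurable φ)
    (hψ : Measurable ψ) : Measurable fun ω => φ ω + ψ ω := hφ.add hψ

theorem measurable_fun_sub {m : MeasurableSpace Ω} {φ ψ : Ω → E d} (hφ : Measurable φ)
    (hψ : Measurable ψ) : Measurable fun ω => φ ω - ψ ω := hφ.sub hψ

theorem measurable_fun_sum {m : MeasurableSpace Ω} {φ : Fin n → Ω → E d}
    (hφ : ∀ i, Measurable (φ i)) : Measurable fun ω => ∑ i, φ i ω :=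
  Finset.measurable_fun_sum _ fun i _ => hφ i

@[fun_prop]
theorem measurable_clip (τ : ℝ) : Measurable (clip (d := d) τ) := by
  unfold clip
  exact Measurable.ite (measurableSet_lt measurable_const measurable_norm) (by fun_prop)
    measurable_id

theorem MeasurableState.step [MeasurableSpace Ω] [MeasurableSpace Ξ] {S : Ω → State n d}
    (hS : MeasurableState S) (γ β β' τ : ℝ) {G : Fin n → E d → Ξ → E d}
    (hG : ∀ i, Measurable (fun p : E d × Ξ => G i p.1 p.2)) {s : Ω → Fin n → Ξ}
    (hs : ∀ i, Measurable fun ω => s ω i) :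
    MeasurableState fun ω => Clip21.step γ β β' τ G (s ω) (S ω) := by
  have hx : Measurable fun ω => (S ω).x - γ • (S ω).g :=
    measurable_fun_sub hS.x (measurable_fun_const_smul hS.g γ)
  have hv : ∀ i, Measurable fun ω =>
      (1 - β) • (S ω).v i + β • G i ((S ω).x - γ • (S ω).g) (s ω i) := fun i =>
    measurable_fun_add (measurable_fun_const_smul (hS.v i) _)
      (measurable_fun_const_smul ((hG i).comp (hx.prodMk (hs i))) β)
  have hc : ∀ i, Measurable fun ω => clip τ
      ((1 - β) • (S ω).v i + β • G i ((S ω).x - γ • (S ω).g) (s ω i) - (S ω).gl i) := fun i =>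
    (measurable_clip τ).comp (measurable_fun_sub (hv i) (hS.gl i))
  exact ⟨hx, measurable_fun_add hS.g (measurable_fun_const_smul (measurable_fun_sum hc) _), hv,
    fun i => measurable_fun_add (hS.gl i) (measurable_fun_const_smul (hc i) _)⟩

/-- The information in the samples up to time `t`. -/
@[reducible]
def pastSigma [MeasurableSpace Ξ] (ξ : ℕ → Fin n → Ω → Ξ) (t : ℕ) : MeasurableSpace Ω :=
  ⨆ p ∈ {p : ℕ × Fin n | p.1 ≤ t}, MeasurableSpace.comap (ξ p.1 p.2) inferInstance

theorem measurable_pastSigma [MeasurableSpace Ξ] (ξ : ℕ → Fin n → Ω → Ξ) {s t : ℕ} (h : s ≤ t)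
    (i : Fin n) : Measurable[pastSigma ξ t] (ξ s i) :=
  measurable_iff_comap_le.2 <| le_iSup₂_of_le (f := fun (p : ℕ × Fin n)
    (_ : p ∈ {p : ℕ × Fin n | p.1 ≤ t}) => MeasurableSpace.comap (ξ p.1 p.2) inferInstance)
    (s, i) h le_rfl

theorem pastSigma_mono [MeasurableSpace Ξ] (ξ : ℕ → Fin n → Ω → Ξ) {s t : ℕ} (h : s ≤ t) :
    pastSigma ξ s ≤ pastSigma ξ t :=
  biSup_mono fun p (hp : p.1 ≤ s) => hp.trans h

theorem pastSigma_le [MeasurableSpace Ξ] [m : MeasurableSpace Ω] {ξ : ℕ → Fin n → Ω → Ξ}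
    (hξ : ∀ t i, Measurable (ξ t i)) (t : ℕ) : pastSigma ξ t ≤ m :=
  iSup₂_le fun p _ => (hξ p.1 p.2).comap_le

theorem MeasurableState.mono {m m' : MeasurableSpace Ω} {S : Ω → State n d} (h : m ≤ m')
    (hS : @MeasurableState n d Ω m S) : @MeasurableState n d Ω m' S :=
  @MeasurableState.mk n d Ω m' S ((@MeasurableState.x n d Ω m S hS).mono h le_rfl)
    ((@MeasurableState.g n d Ω m S hS).mono h le_rfl)
    (fun i => (@MeasurableState.v n d Ω m S hS i).mono h le_rfl)
    (fun i => (@MeasurableState.gl n d Ω m S hS i).mono h le_rfl)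

theorem measurableState_run [MeasurableSpace Ξ] (γ β β' τ : ℝ) {G : Fin n → E d → Ξ → E d}
    (hG : ∀ i, Measurable (fun p : E d × Ξ => G i p.1 p.2)) (x0 : E d) (ξ : ℕ → Fin n → Ω → Ξ)
    (t : ℕ) :
    @MeasurableState n d Ω (pastSigma ξ t)
      (fun ω => run γ β β' τ G x0 (fun t i => ξ t i ω) t) := by
  induction t with
  | zero =>
    exact @MeasurableState.mk n d Ω (pastSigma ξ 0) _ measurable_const measurable_const
      (fun _ => measurable_const) (fun _ => measurable_const)
  | succ t ih =>
    exact @MeasurableState.step n d Ξ Ω (pastSigma ξ (t + 1)) _ _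
      (ih.mono (pastSigma_mono ξ t.le_succ)) γ β β' τ G hG _
      (fun i => measurable_pastSigma ξ le_rfl i)

/-- The iterate is predictable: it is formed from the previous `x` and `g` before the new samples
are drawn, so these are independent of the point at which they are used. -/
theorem measurable_run_succ_x [MeasurableSpace Ξ] (γ β β' τ : ℝ) {G : Fin n → E d → Ξ → E d}
    (hG : ∀ i, Measurable (fun p : E d × Ξ => G i p.1 p.2)) (x0 : E d) (ξ : ℕ → Fin n → Ω → Ξ)
    (t : ℕ) : Measurable[pastSigma ξ t]
      fun ω => (run γ β β' τ G x0 (fun t i => ξ t i ω) (t + 1)).x := by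
  have h := measurableState_run γ β β' τ hG x0 ξ t
  exact measurable_fun_sub (@MeasurableState.x n d Ω (pastSigma ξ t) _ h)
    (measurable_fun_const_smul (@MeasurableState.g n d Ω (pastSigma ξ t) _ h) γ)

theorem measurable_noise [MeasurableSpace Ξ] {f : Fin n → E d → ℝ}
    (hf : ∀ i, Measurable (gradient (f i))) (γ β β' τ : ℝ) {G : Fin n → E d → Ξ → E d}
    (hG : ∀ i, Measurable (fun p : E d × Ξ => G i p.1 p.2)) (x0 : E d) (ξ : ℕ → Fin n → Ω → Ξ)
    (t : ℕ) (i : Fin n) : Measurable[pastSigma ξ t]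
      fun ω => noise f γ β β' τ G x0 (fun t i => ξ t i ω) t i := by
  have h := @MeasurableState.x n d Ω (pastSigma ξ t) _ (measurableState_run γ β β' τ hG x0 ξ t)
  exact measurable_fun_sub ((hG i).comp (h.prodMk (measurable_pastSigma ξ le_rfl i)))
    ((hf i).comp h)

theorem measurable_movingAvg [MeasurableSpace Ξ] {f : Fin n → E d → ℝ}
    (hf : ∀ i, Measurable (gradient (f i))) (γ β β' τ : ℝ) {G : Fin n → E d → Ξ → E d}
    (hG : ∀ i, Measurable (fun p : E d × Ξ => G i p.1 p.2)) (x0 : E d) (ξ : ℕ → Fin n → Ω → Ξ)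
    (b : ℝ) (w : Fin n → ℝ) (t : ℕ) : Measurable[pastSigma ξ t]
      fun ω => movingAvg b w (noise f γ β β' τ G x0 (fun t i => ξ t i ω)) t := by
  induction t with
  | zero => exact measurable_const
  | succ t ih =>
    exact measurable_fun_add
      (measurable_fun_const_smul (ih.mono (pastSigma_mono ξ t.le_succ) le_rfl) (1 - b))
      (measurable_fun_const_smul (measurable_fun_sum fun i => measurable_fun_const_smul
        (measurable_noise hf γ β β' τ hG x0 ξ (t + 1) i) (w i)) b)

variable [MeasurableSpace Ξ] [MeasurableSpace Ω] {P : Measure Ω} {D : Fin n → Measure Ξ}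
  {ξ : ℕ → Fin n → Ω → Ξ}

/-- The times `≤ t` and the time `t + 1` are disjoint blocks of an independent family. -/
theorem IndepSamples.indepFun_next (hξ : IndepSamples P D ξ) {Y : Type*} [MeasurableSpace Y]
    {H : Ω → Y} {t : ℕ} (hH : Measurable[pastSigma ξ t] H) :
    IndepFun H (fun ω i => ξ (t + 1) i ω) P := by
  have h1 := indep_iSup_of_disjoint (m := fun p : ℕ × Fin n =>
      MeasurableSpace.comap (ξ p.1 p.2) inferInstance)
    (fun p => (hξ.measurable p.1 p.2).comap_le) hξ.indep.iIndep
    (S := {p : ℕ × Fin n | p.1 ≤ t}) (T := {p : ℕ × Fin n | p.1 = t + 1})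
    (Set.disjoint_left.2 fun p (hp : p.1 ≤ t) (hp' : p.1 = t + 1) => by omega)
  rw [IndepFun_iff_Indep]
  refine indep_of_indep_of_le_left (indep_of_indep_of_le_right h1 ?_) hH.comap_le
  rw [← measurable_iff_comap_le]
  refine @measurable_pi_lambda _ _ _ (_) _ _ fun i => ?_
  exact measurable_iff_comap_le.2 <| le_iSup₂_of_le (f := fun (p : ℕ × Fin n)
    (_ : p ∈ {p : ℕ × Fin n | p.1 = t + 1}) => MeasurableSpace.comap (ξ p.1 p.2) inferInstance)
    (t + 1, i) rfl le_rfl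

theorem IndepSamples.map_next (hξ : IndepSamples P D ξ) [IsProbabilityMeasure P] (t : ℕ) :
    P.map (fun ω i => ξ t i ω) = Measure.pi D := by
  have h1 := hξ.indep.precomp (g := fun i : Fin n => (t, i)) fun i j h => by simpa using h
  rw [iIndepFun_iff_map_fun_eq_pi_map fun i => (hξ.measurable t i).aemeasurable] at h1
  refine h1.trans ?_
  congr 1
  ext1 i
  exact hξ.law t i

theorem SubGaussianOracle.isNormSubGaussian {σ : ℝ} (hσ : 0 ≤ σ) {f : Fin n → E d → ℝ}
    {G : Fin n → E d → Ξ → E d} [∀ i, IsProbabilityMeasure (D i)]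
    (hG : SubGaussianOracle σ f D G) (i : Fin n) (x : E d) :
    IsNormSubGaussian (D i) (8 * σ ^ 2) (fun s => G i x s - gradient (f i) x) := by
  have hm : Measurable (G i x) := (hG.measurable i).comp (measurable_const.prodMk measurable_id)
  refine isNormSubGaussian_of_lintegral_le (hm.sub_const _)
    ((hG.integrable i x).sub (integrable_const _)) ?_ hσ (hG.subGaussian i x) fun h => ?_
  · rw [integral_sub (hG.integrable i x) (integrable_const _), hG.unbiased i x]
    simp
  · filter_upwards [hG.noiseless h i x] with s hs
    rw [hs, sub_self]

/-- At a fixed point the noises of the workers are independent, so proxies add with weights `wᵢ²`;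
weights `1 / n` yield the gain `1 / n`. -/
theorem SubGaussianOracle.isNormSubGaussian_pi {σ : ℝ} (hσ : 0 ≤ σ) {f : Fin n → E d → ℝ}
    {G : Fin n → E d → Ξ → E d} [∀ i, IsProbabilityMeasure (D i)]
    (hG : SubGaussianOracle σ f D G) (b : ℝ) (w : Fin n → ℝ) (x : E d) :
    IsNormSubGaussian (Measure.pi D) (b ^ 2 * ∑ i, w i ^ 2 * (8 * σ ^ 2))
      (fun z => b • ∑ i, w i • (G i x (z i) - gradient (f i) x)) := by
  have hm : ∀ i, Measurable (fun s => w i • (G i x s - gradient (f i) x)) := fun i =>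
    measurable_fun_const_smul (measurable_fun_sub
      ((hG.measurable i).comp (measurable_const.prodMk measurable_id)) measurable_const) _
  refine IsNormSubGaussian.smul (IsNormSubGaussian.sum
    (X := fun i (z : Fin n → Ξ) => w i • (G i x (z i) - gradient (f i) x)) (fun i => by positivity)
    (fun i => (hm i).comp (measurable_pi_apply i)) (fun i S h hh => ?_)
    (iIndepFun_pi fun i => (hm i).aemeasurable) _) b
  have h1 := ((hG.isNormSubGaussian hσ i x).smul (w i)) S h hh
  rw [← (measurePreserving_eval D i).map_eq, lintegral_map _ (measurable_pi_apply i)] at h1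
  · exact h1
  · have := hm i
    fun_prop

/-- The moving averages of the noise have Gaussian norm tails with variance proxy
`8 σ² b ∑ᵢ wᵢ²`. -/
theorem hasGaussianNorm_movingAvg [IsProbabilityMeasure P] {σ : ℝ} (hσ : 0 ≤ σ)
    {f : Fin n → E d → ℝ} (hf : ∀ i, Measurable (gradient (f i))) {G : Fin n → E d → Ξ → E d}
    (hG : SubGaussianOracle σ f D G) (hξ : IndepSamples P D ξ) (γ β β' τ : ℝ) (x0 : E d) {b : ℝ}
    (hb : 0 ≤ b) (hb1 : b ≤ 1) (w : Fin n → ℝ) (t : ℕ) :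
    HasGaussianNorm P (b * ∑ i, w i ^ 2 * (8 * σ ^ 2))
      (fun ω => movingAvg b w (noise f γ β β' τ G x0 (fun t i => ξ t i ω)) t) := by
  set W := ∑ i, w i ^ 2 * (8 * σ ^ 2) with hW
  have hW0 : 0 ≤ W := Finset.sum_nonneg fun i _ => by positivity
  have hD : ∀ i, IsProbabilityMeasure (D i) := fun i => by
    rw [← hξ.law 0 i]
    exact Measure.isProbabilityMeasure_map (hξ.measurable 0 i).aemeasurable
  induction t with
  | zero =>
    intro h hh
    have : 0 ≤ b * W / (h - b * W) := div_nonneg (by positivity) (by linarith)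
    simpa [movingAvg, eexp_zero] using eexp_mono this
  | succ t ih =>
    have hM := measurable_movingAvg hf γ β β' τ hG.measurable x0 ξ b w t
    have hx := measurable_run_succ_x γ β β' τ hG.measurable x0 ξ t
    -- The relevant history is the current moving average together with the next query point.
    have hH := hM.prodMk hx
    have hXm : Measurable fun p : (E d × E d) × (Fin n → Ξ) =>
        b • ∑ i, w i • (G i p.1.2 (p.2 i) - gradient (f i) p.1.2) := by
      have hx2 : Measurable fun p : (E d × E d) × (Fin n → Ξ) => p.1.2 :=
        measurable_snd.comp measurable_fst
      have hz : ∀ i, Measurable fun p : (E d × E d) × (Fin n → Ξ) => p.2 i := fun i =>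
        (measurable_pi_apply i).comp measurable_snd
      exact measurable_fun_const_smul (measurable_fun_sum fun i => measurable_fun_const_smul
        (measurable_fun_sub ((hG.measurable i).comp (hx2.prodMk (hz i))) ((hf i).comp hx2)) _) b
    have key := HasGaussianNorm.add_of_indepFun (hH.mono (pastSigma_le hξ.measurable t) le_rfl)
      (measurable_pi_lambda _ fun i => hξ.measurable (t + 1) i) (hξ.indepFun_next hH)
      (S := fun y : E d × E d => (1 - b) • y.1)
      (X := fun y z => b • ∑ i, w i • (G i y.2 (z i) - gradient (f i) y.2))
      (by fun_prop) hXm (s := b ^ 2 * W) (r := (1 - b) ^ 2 * (b * W)) (by positivity)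
      (by positivity)
      (fun y => by rw [hξ.map_next]; exact hG.isNormSubGaussian_pi hσ b w y.2)
      (ih.smul (1 - b))
    refine HasGaussianNorm.mono (by positivity) ?_ key
    -- This is the gap in `b² W + (1 - b)² b W ≤ b W`, which makes the proxy `b W` stable in time.
    have : 0 ≤ b * W * (b * (1 - b)) := mul_nonneg (by positivity) (mul_nonneg hb (by linarith))
    nlinarith

end Noise

/-! ### Energy estimate for doubly averaged gradient descent. -/

section Energy

variable {F : Type*} [NormedAddCommGroup F] [InnerProductSpace ℝ F]

/-- The bias of the momentum estimate `v` of `A`, after removal of its noise part `m`. -/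
theorem momentum_bias_succ {β : ℝ} {v m A η : ℕ → F}
    (hv : ∀ t, v (t + 1) = (1 - β) • v t + β • (η (t + 1) + A (t + 1)))
    (hm : ∀ t, m (t + 1) = (1 - β) • m t + β • η (t + 1)) (t : ℕ) :
    v (t + 1) - A (t + 1) - m (t + 1) = (1 - β) • ((v t - A t - m t) + (A t - A (t + 1))) := by
  rw [hv, hm]
  module

theorem norm_add_three_sq_le {F : Type*} [NormedAddCommGroup F] (a b c : F) :
    ‖a + b + c‖ ^ 2 ≤ 3 * (‖a‖ ^ 2 + ‖b‖ ^ 2 + ‖c‖ ^ 2) := by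
  have h : ‖a + b + c‖ ≤ ‖a‖ + ‖b‖ + ‖c‖ := norm_add₃_le
  have h1 : ‖a + b + c‖ ^ 2 ≤ (‖a‖ + ‖b‖ + ‖c‖) ^ 2 := by gcongr
  nlinarith [sq_nonneg (‖a‖ - ‖b‖), sq_nonneg (‖a‖ - ‖c‖), sq_nonneg (‖b‖ - ‖c‖)]

theorem norm_sub_add_sub_sq_le {F : Type*} [NormedAddCommGroup F] (a b c e : F) :
    ‖(a - b) + (c - e)‖ ^ 2 ≤ 4 * (‖a‖ ^ 2 + ‖b‖ ^ 2 + ‖c‖ ^ 2 + ‖e‖ ^ 2) := by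
  have h : ‖(a - b) + (c - e)‖ ≤ (‖a‖ + ‖b‖) + (‖c‖ + ‖e‖) :=
    (norm_add_le _ _).trans (add_le_add (norm_sub_le _ _) (norm_sub_le _ _))
  have h1 : ‖(a - b) + (c - e)‖ ^ 2 ≤ ((‖a‖ + ‖b‖) + (‖c‖ + ‖e‖)) ^ 2 := by gcongr
  nlinarith [sq_nonneg (‖a‖ - ‖b‖), sq_nonneg (‖a‖ - ‖c‖), sq_nonneg (‖b‖ - ‖c‖),
    sq_nonneg (‖a‖ - ‖e‖), sq_nonneg (‖b‖ - ‖e‖), sq_nonneg (‖c‖ - ‖e‖)]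

/-- Energy estimate for gradient descent with a doubly averaged gradient estimate: `v` is a
momentum estimate with noise part `m`, and `g` is an exponential average of `v`. -/
theorem sum_norm_sq_le_of_double_momentum [CompleteSpace F] {φ : F → ℝ} {L γ β q M Δ : ℝ}
    (hφ : Differentiable ℝ φ) (hL : ∀ x y, ‖gradient φ x - gradient φ y‖ ≤ L * ‖x - y‖)
    (hb : BddBelow (Set.range φ)) (hL0 : 0 < L) (hβ : 0 < β) (hβ1 : β ≤ 1) (hq : 0 < q) (hq1 : q ≤ 1)
    (hγ : γ = q ^ 2 / 108 * β / L) {x g v m η : ℕ → F} {K : ℕ}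
    (hx : ∀ t, x (t + 1) = x t - γ • g t)
    (hv : ∀ t, v (t + 1) = (1 - β) • v t + β • (η (t + 1) + gradient φ (x (t + 1))))
    (hm : ∀ t, m (t + 1) = (1 - β) • m t + β • η (t + 1))
    (hg : ∀ t < K, g (t + 1) = g t + q • (v (t + 1) - g t))
    (hv0 : v 0 = 0) (hm0 : m 0 = 0) (hg0 : g 0 = 0) (hM : ∀ t ≤ K, ‖m t‖ ^ 2 ≤ M)
    (hΔ : φ (x 0) - (⨅ y, φ y) ≤ Δ) :
    γ / 2 * ∑ t ∈ Finset.range (K + 1), ‖gradient φ (x t)‖ ^ 2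
      + γ / 8 * ∑ t ∈ Finset.range (K + 1), ‖g t‖ ^ 2
      ≤ 5 / 4 * Δ + β * (K + 1) * M / (8 * L) := by
  set A : ℕ → F := fun t => gradient φ (x t) with hA
  set u : ℕ → F := fun t => v t - A t - m t with hu
  set c : ℝ := q ^ 2 / 108 with hc
  have hc0 : 0 < c := by positivity
  have hγ0 : 0 < γ := by rw [hγ]; positivity
  have hLγ : L * γ = c * β := by rw [hγ]; field_simp
  have hLγ2 : L * γ ≤ 1 / 2 := by rw [hLγ, hc]; nlinarith
  set S := ∑ t ∈ Finset.range (K + 1), ‖g t‖ ^ 2 with hS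
  set U := ∑ t ∈ Finset.range (K + 1), ‖u t‖ ^ 2 with hU
  set Bs := ∑ t ∈ Finset.range (K + 1), ‖g t - v t‖ ^ 2 with hBs
  have hM0 : 0 ≤ M := (sq_nonneg _).trans (hM 0 (Nat.zero_le _))
  have hS0 : 0 ≤ S := Finset.sum_nonneg fun _ _ => sq_nonneg _
  have hSK : ∑ t ∈ Finset.range K, ‖g t‖ ^ 2 ≤ S := by
    rw [hS, Finset.sum_range_succ]; linarith [sq_nonneg ‖g K‖]
  have hUK : ∑ t ∈ Finset.range K, ‖u t‖ ^ 2 ≤ U := by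
    rw [hU, Finset.sum_range_succ]; linarith [sq_nonneg ‖u K‖]
  have hdrift : ∀ t, ‖A t - A (t + 1)‖ ^ 2 ≤ (c * β) ^ 2 * ‖g t‖ ^ 2 := fun t => by
    have h1 := hL (x t) (x (t + 1))
    rw [hx t, sub_sub_cancel, norm_smul, Real.norm_of_nonneg hγ0.le, ← mul_assoc, hLγ, ← hx t] at h1
    rw [← mul_pow]
    exact pow_le_pow_left₀ (norm_nonneg _) h1 2
  have hu0 : ‖u 0‖ ^ 2 ≤ 2 * L * Δ := by
    have h1 := norm_gradient_sq_le_of_lipschitz_gradient hL0 hφ hL hb (x 0)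
    have h2 : ‖u 0‖ = ‖gradient φ (x 0)‖ := by simp [hu, hA, hv0, hm0]
    rw [h2]
    refine h1.trans ?_
    gcongr
  have hUle : β * U ≤ 2 * L * Δ + c ^ 2 * β * S := by
    have h1 := sum_add_le_of_contraction (a := fun t => ‖u t‖ ^ 2)
      (c := fun t => ‖A t - A (t + 1)‖ ^ 2 / β) (q := β) (K := K) fun t _ => by
        simp only [hu]
        rw [momentum_bias_succ (A := A) hv hm t]
        exact norm_smul_add_sq_le hβ hβ1 _ _
    have h2 : ∑ t ∈ Finset.range K, ‖A t - A (t + 1)‖ ^ 2 / β ≤ c ^ 2 * β * S := by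
      calc ∑ t ∈ Finset.range K, ‖A t - A (t + 1)‖ ^ 2 / β
          ≤ ∑ t ∈ Finset.range K, c ^ 2 * β * ‖g t‖ ^ 2 := by
            refine Finset.sum_le_sum fun t _ => ?_
            rw [div_le_iff₀ hβ]
            refine (hdrift t).trans_eq ?_
            ring
        _ ≤ c ^ 2 * β * S := by
            rw [← Finset.mul_sum]
            gcongr
    have h3 : U = ∑ t ∈ Finset.range K, ‖u t‖ ^ 2 + ‖u K‖ ^ 2 := Finset.sum_range_succ _ _
    have h4 : β * ‖u K‖ ^ 2 ≤ ‖u K‖ ^ 2 := mul_le_of_le_one_left (sq_nonneg _) hβ1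
    rw [h3, mul_add]
    linarith
  have hBle : q ^ 2 * Bs ≤ 8 * ((K + 1) * M) + 4 * c ^ 2 * S + 4 * U := by
    have h1 := sum_add_le_of_contraction (a := fun t => ‖g t - v t‖ ^ 2)
      (c := fun t => ‖v t - v (t + 1)‖ ^ 2 / q) (q := q) (K := K) fun t ht => by
        have e : g (t + 1) - v (t + 1) = (1 - q) • ((g t - v t) + (v t - v (t + 1))) := by
          rw [hg t ht]
          module
        simp only [e]
        exact norm_smul_add_sq_le hq hq1 _ _
    have h2 : ∑ t ∈ Finset.range K, ‖v t - v (t + 1)‖ ^ 2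
        ≤ 8 * ((K + 1) * M) + 4 * c ^ 2 * S + 4 * U := by
      calc ∑ t ∈ Finset.range K, ‖v t - v (t + 1)‖ ^ 2
          ≤ ∑ t ∈ Finset.range K, (8 * M + 4 * c ^ 2 * ‖g t‖ ^ 2 + 4 * ‖u t‖ ^ 2) := by
            refine Finset.sum_le_sum fun t ht => ?_
            have htK := Finset.mem_range.1 ht
            -- Written with `m` and the bias `u`, the increment involves no individual noise term,
            -- only moving averages bounded by `M`.
            have e : v t - v (t + 1)
                = (m t - m (t + 1)) + (β • (A t - A (t + 1)) - (-β) • u t) := by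
              simp only [hu, hv t, hm t, hA]
              module
            have h3 := norm_sub_add_sub_sq_le (m t) (m (t + 1)) (β • (A t - A (t + 1)))
              ((-β) • u t)
            rw [← e, norm_smul, norm_smul, norm_neg, Real.norm_of_nonneg hβ.le, mul_pow,
              mul_pow] at h3
            have h4 := hM t (by omega)
            have h5 := hM (t + 1) (by omega)
            have hβ2 : β ^ 2 ≤ 1 := pow_le_one₀ hβ.le hβ1
            have h6 : β ^ 2 * ‖A t - A (t + 1)‖ ^ 2 ≤ c ^ 2 * ‖g t‖ ^ 2 := by
              calc β ^ 2 * ‖A t - A (t + 1)‖ ^ 2 ≤ 1 * ((c * β) ^ 2 * ‖g t‖ ^ 2) :=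
                    mul_le_mul hβ2 (hdrift t) (sq_nonneg _) zero_le_one
                _ = c ^ 2 * (β ^ 2 * ‖g t‖ ^ 2) := by ring
                _ ≤ c ^ 2 * ‖g t‖ ^ 2 := by
                    gcongr
                    exact mul_le_of_le_one_left (sq_nonneg _) hβ2
            have h7 : β ^ 2 * ‖u t‖ ^ 2 ≤ ‖u t‖ ^ 2 := mul_le_of_le_one_left (sq_nonneg _) hβ2
            linarith
        _ ≤ _ := by
            rw [Finset.sum_add_distrib, Finset.sum_add_distrib, ← Finset.mul_sum, ← Finset.mul_sum,
              ← Finset.mul_sum, Finset.sum_const, Finset.card_range, nsmul_eq_mul]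
            have : 4 * c ^ 2 * ∑ t ∈ Finset.range K, ‖g t‖ ^ 2 ≤ 4 * c ^ 2 * S := by gcongr
            linarith
    have h3 : Bs = ∑ t ∈ Finset.range K, ‖g t - v t‖ ^ 2 + ‖g K - v K‖ ^ 2 :=
      Finset.sum_range_succ _ _
    have h4 : q * ‖g K - v K‖ ^ 2 ≤ ‖g K - v K‖ ^ 2 := mul_le_of_le_one_left (sq_nonneg _) hq1
    have h5 : q * Bs ≤ (∑ t ∈ Finset.range K, ‖v t - v (t + 1)‖ ^ 2) / q := by
      rw [h3, mul_add, Finset.sum_div]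
      simp only [hg0, hv0, sub_self, norm_zero] at h1
      linarith
    rw [le_div_iff₀ hq] at h5
    linarith
  have herr : ∑ t ∈ Finset.range (K + 1), ‖g t - A t‖ ^ 2 ≤ 3 * (Bs + U + (K + 1) * M) := by
    calc ∑ t ∈ Finset.range (K + 1), ‖g t - A t‖ ^ 2
        ≤ ∑ t ∈ Finset.range (K + 1), 3 * (‖g t - v t‖ ^ 2 + ‖u t‖ ^ 2 + M) := by
          refine Finset.sum_le_sum fun t ht => ?_
          have e : g t - A t = (g t - v t) + u t + m t := by simp only [hu]; abel
          have h1 := norm_add_three_sq_le (g t - v t) (u t) (m t)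
          rw [← e] at h1
          have := hM t (by have := Finset.mem_range.1 ht; omega)
          linarith
      _ = _ := by
          rw [← Finset.mul_sum, Finset.sum_add_distrib, Finset.sum_add_distrib, Finset.sum_const,
            Finset.card_range, nsmul_eq_mul]
          push_cast
          rfl
  have hdesc : ∀ N : ℕ, φ (x N) + γ / 2 * ∑ t ∈ Finset.range N, ‖A t‖ ^ 2
      + γ / 4 * ∑ t ∈ Finset.range N, ‖g t‖ ^ 2
      ≤ φ (x 0) + γ / 2 * ∑ t ∈ Finset.range N, ‖g t - A t‖ ^ 2 := by
    intro N
    induction N with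
    | zero => simp
    | succ N ih =>
      have h1 := inexact_descent hφ hL hγ0.le hLγ2 (x N) (g N)
      rw [← hx N] at h1
      simp only [Finset.sum_range_succ, mul_add]
      simp only [hA] at ih ⊢
      linarith
  have h1 := hdesc (K + 1)
  have h2 := ciInf_le hb (x (K + 1))
  -- The error is absorbed: half of the available `γ/4 ∑ ‖g‖²` pays for the drift, because `27 c² ≤
  -- 27 c`. The rest of it is kept, for control of the local gradients later.
  have h3 : γ / 2 * ∑ t ∈ Finset.range (K + 1), ‖g t - A t‖ ^ 2
      ≤ β * (K + 1) * M / (8 * L) + γ / 8 * S + 1 / 4 * Δ := by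
    have hΔ0 : 0 ≤ Δ := by linarith [ciInf_le hb (x 0)]
    have h4 : q ^ 2 * ∑ t ∈ Finset.range (K + 1), ‖g t - A t‖ ^ 2
        ≤ 27 * ((K + 1) * M) + 12 * c ^ 2 * S + 15 * U := by
      have h5 : q ^ 2 * (U + (K + 1) * M) ≤ 1 * (U + (K + 1) * M) := by
        have : q ^ 2 ≤ 1 := pow_le_one₀ hq.le hq1
        have : 0 ≤ U := Finset.sum_nonneg fun _ _ => sq_nonneg _
        gcongr
      have := mul_le_mul_of_nonneg_left herr (sq_nonneg q)
      linarith
    have h6 : β * (q ^ 2 * ∑ t ∈ Finset.range (K + 1), ‖g t - A t‖ ^ 2)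
        ≤ 27 * β * ((K + 1) * M) + 27 * c ^ 2 * β * S + 30 * L * Δ := by
      have := mul_le_mul_of_nonneg_left h4 hβ.le
      linarith
    have e : γ / 2 * ∑ t ∈ Finset.range (K + 1), ‖g t - A t‖ ^ 2
        = β * (q ^ 2 * ∑ t ∈ Finset.range (K + 1), ‖g t - A t‖ ^ 2) / (216 * L) := by
      rw [hγ, hc]
      field_simp
      ring
    rw [e, div_le_iff₀ (by positivity)]
    refine h6.trans ?_
    have e2 : (β * (K + 1) * M / (8 * L) + γ / 8 * S + 1 / 4 * Δ) * (216 * L)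
        = 27 * β * ((K + 1) * M) + 27 * (L * γ) * S + 54 * L * Δ := by
      field_simp
      ring
    rw [e2, hLγ]
    have h7 : c ^ 2 * β * S ≤ c * β * S := by
      have : c ^ 2 ≤ c := by
        have : c ≤ 1 := by rw [hc]; nlinarith
        nlinarith
      gcongr
    have : 0 ≤ L * Δ := by positivity
    linarith
  linarith

end Energy

/-! ### The run on the good noise event: no clipping, and convergence. -/

section Run

variable {n d : ℕ} {Ξ : Type*}

theorem movingAvg_single_succ (b : ℝ) (i : Fin n) (ε : ℕ → Fin n → E d) (t : ℕ) :
    movingAvg b (Pi.single i 1) ε (t + 1)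
      = (1 - b) • movingAvg b (Pi.single i 1) ε t + b • ε (t + 1) i := by
  simp [movingAvg, Pi.single_apply]

theorem run_succ_v (f : Fin n → E d → ℝ) (γ β β' τ : ℝ) (G : Fin n → E d → Ξ → E d) (x0 : E d)
    (s : ℕ → Fin n → Ξ) (t : ℕ) (i : Fin n) :
    (run γ β β' τ G x0 s (t + 1)).v i = (1 - β) • (run γ β β' τ G x0 s t).v i
      + β • (noise f γ β β' τ G x0 s (t + 1) i
        + gradient (f i) (run γ β β' τ G x0 s (t + 1)).x) := by
  rw [noise, sub_add_cancel]
  rfl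

theorem run_succ_gl (γ β β' τ : ℝ) (G : Fin n → E d → Ξ → E d) (x0 : E d) (s : ℕ → Fin n → Ξ)
    (t : ℕ) (i : Fin n) :
    (run γ β β' τ G x0 s (t + 1)).gl i = (run γ β β' τ G x0 s t).gl i
      + β' • clip τ ((run γ β β' τ G x0 s (t + 1)).v i - (run γ β β' τ G x0 s t).gl i) := rfl

/-- The server receives the mean of the very increments that the workers apply, clipped or not, and
all start from zero. -/
theorem run_g_eq_average (γ β β' τ : ℝ) (G : Fin n → E d → Ξ → E d) (x0 : E d)
    (s : ℕ → Fin n → Ξ) (t : ℕ) :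
    (run γ β β' τ G x0 s t).g = (1 / (n : ℝ)) • ∑ i, (run γ β β' τ G x0 s t).gl i := by
  induction t with
  | zero => simp [run]
  | succ t ih =>
    have h : (run γ β β' τ G x0 s (t + 1)).g = (run γ β β' τ G x0 s t).g + (β' / (n : ℝ)) •
      ∑ i, clip τ ((run γ β β' τ G x0 s (t + 1)).v i - (run γ β β' τ G x0 s t).gl i) := rfl
    simp only [h, ih, run_succ_gl, Finset.sum_add_distrib, ← Finset.smul_sum, smul_add, smul_smul]
    congr 2
    ring

theorem clip_of_norm_le {τ : ℝ} {y : E d} (h : ‖y‖ ≤ τ) : clip τ y = y := if_neg h.not_gt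

/-- In the first `K` steps of the run no worker clips. -/
def NoClip (γ β β' τ : ℝ) (G : Fin n → E d → Ξ → E d) (x0 : E d) (s : ℕ → Fin n → Ξ) (K : ℕ) :
    Prop :=
  ∀ t < K, ∀ i, ‖(run γ β β' τ G x0 s (t + 1)).v i - (run γ β β' τ G x0 s t).gl i‖ ≤ τ

/-- The bounds on the noise up to time `T` under which the run converges. -/
structure NoiseBounds (ε : ℕ → Fin n → E d) (β σ ι : ℝ) (T : ℕ) : Prop where
  sample : ∀ t < T, ∀ i, ‖ε (t + 1) i‖ ^ 2 ≤ 16 * σ ^ 2 * ι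
  local_avg : ∀ t < T, ∀ i, ‖movingAvg β (Pi.single i 1) ε t‖ ^ 2 ≤ 16 * β * σ ^ 2 * ι
  avg : ∀ t < T, ‖movingAvg β (fun _ => 1 / (n : ℝ)) ε t‖ ^ 2 ≤ 16 * β * (σ ^ 2 / n) * ι

variable {f : Fin n → E d → ℝ} {L Δ B γ β q τ σ ι : ℝ} {G : Fin n → E d → Ξ → E d} {x0 : E d}
  {s : ℕ → Fin n → Ξ} {T K : ℕ}

/-- Averaging the unclipped recursions over workers gives the double momentum scheme for `avgLoss
f`. The condition on `β² T σ²` keeps the accumulated noise below `2 ι Δ`. -/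
theorem sum_norm_sq_le_of_noClip (hn : 1 ≤ n) (hf : SmoothProblem L f) (hL : 0 < L) (hβ : 0 < β)
    (hβ1 : β ≤ 1) (hq : 0 < q) (hq1 : q ≤ 1) (hγ : γ = q ^ 2 / 108 * β / L) (hι : 1 ≤ ι)
    (hΔ : avgLoss f x0 - (⨅ x, avgLoss f x) ≤ Δ)
    (hN : NoiseBounds (noise f γ β q τ G x0 s) β σ ι T) (hβσ : β ^ 2 * T * σ ^ 2 ≤ n * L * Δ)
    (hK : K < T) (hclip : NoClip γ β q τ G x0 s K) :
    γ / 2 * ∑ t ∈ Finset.range (K + 1), ‖gradient (avgLoss f) (run γ β q τ G x0 s t).x‖ ^ 2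
      + γ / 8 * ∑ t ∈ Finset.range (K + 1), ‖(run γ β q τ G x0 s t).g‖ ^ 2 ≤ 4 * ι * Δ := by
  have hn0 : (0 : ℝ) < n := by exact_mod_cast hn
  have key := sum_norm_sq_le_of_double_momentum (φ := avgLoss f) hf.differentiable_avgLoss
    (hf.norm_gradient_avgLoss_sub_le hL.le) hf.bddBelow hL hβ hβ1 hq hq1 hγ
    (x := fun t => (run γ β q τ G x0 s t).x) (g := fun t => (run γ β q τ G x0 s t).g)
    (v := fun t => (1 / (n : ℝ)) • ∑ i, (run γ β q τ G x0 s t).v i)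
    (m := movingAvg β (fun _ => 1 / (n : ℝ)) (noise f γ β q τ G x0 s))
    (η := fun t => ∑ i, (1 / (n : ℝ)) • noise f γ β q τ G x0 s t i) (K := K)
    (M := 16 * β * (σ ^ 2 / n) * ι) (Δ := Δ) (fun t => rfl)
    (fun t => by
      simp only [gradient_avgLoss hf.differentiable, run_succ_v f, Finset.sum_add_distrib,
        ← Finset.smul_sum]
      module)
    (fun t => rfl)
    (fun t ht => by
      simp only [run_g_eq_average, run_succ_gl, clip_of_norm_le (hclip t ht _),
        Finset.sum_add_distrib, Finset.sum_sub_distrib, ← Finset.smul_sum]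
      module)
    (by simp [run]) rfl rfl (fun t ht => hN.avg t (by omega)) hΔ
  refine key.trans ?_
  have hΔ0 : 0 ≤ Δ := by linarith [ciInf_le hf.bddBelow x0]
  have hKT : (K : ℝ) + 1 ≤ T := by exact_mod_cast hK
  have h1 : β * (K + 1) * (16 * β * (σ ^ 2 / n) * ι) / (8 * L) ≤ 2 * ι * Δ := by
    rw [div_le_iff₀ (by positivity)]
    calc β * (K + 1) * (16 * β * (σ ^ 2 / n) * ι) ≤ β * T * (16 * β * (σ ^ 2 / n) * ι) := by gcongr
      _ = 16 * ι * (β ^ 2 * T * σ ^ 2) / n := by ring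
      _ ≤ 16 * ι * (n * L * Δ) / n := by gcongr
      _ = 2 * ι * Δ * (8 * L) := by field_simp; ring
  nlinarith

/-- An unclipped update closes the fraction `q` of a gap of at most `τ`; at time zero both vectors
vanish. -/
theorem norm_gl_sub_v_le_of_noClip (hq1 : q ≤ 1) (hτ : 0 ≤ τ)
    (hclip : NoClip γ β q τ G x0 s K) (i : Fin n) :
    ‖(run γ β q τ G x0 s K).gl i - (run γ β q τ G x0 s K).v i‖ ≤ (1 - q) * τ := by
  have hq1' : 0 ≤ 1 - q := by linarith
  cases K with
  | zero => simpa [run] using mul_nonneg hq1' hτ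
  | succ K =>
    have h1 := hclip K (Nat.lt_succ_self K) i
    rw [run_succ_gl, clip_of_norm_le h1]
    have e : (run γ β q τ G x0 s K).gl i + q • ((run γ β q τ G x0 s (K + 1)).v i
        - (run γ β q τ G x0 s K).gl i) - (run γ β q τ G x0 s (K + 1)).v i
        = -((1 - q) • ((run γ β q τ G x0 s (K + 1)).v i - (run γ β q τ G x0 s K).gl i)) := by
      module
    rw [e, norm_neg, norm_smul, Real.norm_of_nonneg hq1']
    gcongr

/-- The increment is `β` times a combination of fresh noise, averaged noise, gradient drift and
bias. The bias starts at norm at most `B` because the momentum starts at zero, and afterwards grows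
only by drift, which `∑ ‖g‖²` controls through the smoothness of each single loss. -/
theorem norm_v_succ_sub_v_le (hf : SmoothProblem L f) (hL : 0 < L) (hβ : 0 < β) (hβ1 : β ≤ 1)
    (hq : 0 < q) (hq1 : q ≤ 1) (hγ : γ = q ^ 2 / 108 * β / L) (hσ : 0 ≤ σ) (hι : 1 ≤ ι)
    (hΔ0 : 0 ≤ Δ) (hB : ∀ i, ‖gradient (f i) x0‖ ≤ B)
    (hN : NoiseBounds (noise f γ β q τ G x0 s) β σ ι T) (hK : K < T)
    (hS : γ / 8 * ∑ t ∈ Finset.range (K + 1), ‖(run γ β q τ G x0 s t).g‖ ^ 2 ≤ 4 * ι * Δ)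
    (i : Fin n) :
    ‖(run γ β q τ G x0 s (K + 1)).v i - (run γ β q τ G x0 s K).v i‖
      ≤ 8 * β * ι * (σ + B + √(L * Δ)) := by
  set x : ℕ → E d := fun t => (run γ β q τ G x0 s t).x with hx
  set g : ℕ → E d := fun t => (run γ β q τ G x0 s t).g with hg
  set v : ℕ → E d := fun t => (run γ β q τ G x0 s t).v i with hv
  set A : ℕ → E d := fun t => gradient (f i) (x t) with hA
  set ε := noise f γ β q τ G x0 s with hε
  set m : ℕ → E d := movingAvg β (Pi.single i 1) ε with hm
  set c : ℝ := q ^ 2 / 108 with hc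
  have hc0 : 0 < c := by positivity
  have hB0 : 0 ≤ B := (norm_nonneg _).trans (hB i)
  have hγ0 : 0 < γ := by rw [hγ]; positivity
  have hLγ : L * γ = c * β := by rw [hγ]; field_simp
  have hvs : ∀ t, v (t + 1) = (1 - β) • v t + β • (ε (t + 1) i + A (t + 1)) := fun t =>
    run_succ_v f γ β q τ G x0 s t i
  have hms : ∀ t, m (t + 1) = (1 - β) • m t + β • ε (t + 1) i := movingAvg_single_succ β i ε
  set S := ∑ t ∈ Finset.range (K + 1), ‖g t‖ ^ 2 with hSdef
  have hSle : c ^ 2 * β * S ≤ ι * (L * Δ) := by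
    have h1 : c ^ 2 * β * S = 8 * c * L * (γ / 8 * S) := by
      linear_combination (-c * S) * hLγ
    rw [h1]
    calc 8 * c * L * (γ / 8 * S) ≤ 8 * c * L * (4 * ι * Δ) := by gcongr
      _ = 32 * c * (ι * (L * Δ)) := by ring
      _ ≤ 1 * (ι * (L * Δ)) := by
          have : 32 * c ≤ 1 := by rw [hc]; nlinarith
          gcongr
      _ = _ := one_mul _
  have hdrift : ∀ t, ‖A t - A (t + 1)‖ ^ 2 ≤ (c * β) ^ 2 * ‖g t‖ ^ 2 := fun t => by
    have h1 := hf.smooth i (x t) (x (t + 1))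
    have h2 : x (t + 1) = x t - γ • g t := rfl
    rw [h2, sub_sub_cancel, norm_smul, Real.norm_of_nonneg hγ0.le, ← mul_assoc, hLγ, ← h2] at h1
    rw [← mul_pow]
    exact pow_le_pow_left₀ (norm_nonneg _) h1 2
  have hdrift' : ∀ t, ‖A t - A (t + 1)‖ ^ 2 / β ≤ c ^ 2 * β * ‖g t‖ ^ 2 := fun t => by
    rw [div_le_iff₀ hβ]
    refine (hdrift t).trans_eq ?_
    ring
  have hr0 : 0 ≤ ι * √(L * Δ) := by positivity
  have hr : ι * (L * Δ) ≤ (ι * √(L * Δ)) ^ 2 := by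
    rw [mul_pow, Real.sq_sqrt (by positivity)]
    have : ι ≤ ι ^ 2 := by nlinarith
    gcongr
  have hbias : ‖v K - A K - m K‖ ≤ B + ι * √(L * Δ) := by
    have h1 := sum_add_le_of_contraction (a := fun t => ‖v t - A t - m t‖ ^ 2)
      (c := fun t => ‖A t - A (t + 1)‖ ^ 2 / β) (q := β) (K := K) fun t _ => by
        simp only [momentum_bias_succ (A := A) (η := fun t => ε t i) hvs hms t]
        exact norm_smul_add_sq_le hβ hβ1 _ _
    have h2 : ∑ t ∈ Finset.range K, ‖A t - A (t + 1)‖ ^ 2 / β ≤ c ^ 2 * β * S := by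
      refine (Finset.sum_le_sum fun t _ => hdrift' t).trans ?_
      rw [← Finset.mul_sum, hSdef, Finset.sum_range_succ]
      have : 0 ≤ c ^ 2 * β * ‖g K‖ ^ 2 := by positivity
      linarith
    have h3 : ‖v 0 - A 0 - m 0‖ ^ 2 ≤ B ^ 2 := by
      have e : v 0 - A 0 - m 0 = -gradient (f i) x0 := by
        simp [hv, hA, hm, hx, run, movingAvg]
      rw [e, norm_neg]
      exact pow_le_pow_left₀ (norm_nonneg _) (hB i) 2
    have h4 : 0 ≤ β * ∑ t ∈ Finset.range K, ‖v t - A t - m t‖ ^ 2 :=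
      mul_nonneg hβ.le (Finset.sum_nonneg fun _ _ => sq_nonneg _)
    refine (sq_le_sq₀ (norm_nonneg _) (by positivity)).1 ?_
    nlinarith [mul_nonneg hB0 hr0]
  have hdriftK : ‖A (K + 1) - A K‖ ≤ ι * √(L * Δ) := by
    refine (sq_le_sq₀ (norm_nonneg _) hr0).1 ?_
    rw [norm_sub_rev]
    have h1 : ‖A K - A (K + 1)‖ ^ 2 ≤ ‖A K - A (K + 1)‖ ^ 2 / β :=
      le_div_self (sq_nonneg _) hβ hβ1
    have h2 : c ^ 2 * β * ‖g K‖ ^ 2 ≤ c ^ 2 * β * S := by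
      rw [hSdef, Finset.sum_range_succ]
      have : 0 ≤ ∑ t ∈ Finset.range K, ‖g t‖ ^ 2 := Finset.sum_nonneg fun _ _ => sq_nonneg _
      gcongr
      linarith
    linarith [hdrift' K]
  have hsq : 16 * σ ^ 2 * ι ≤ (4 * σ * ι) ^ 2 := by
    have : ι ≤ ι ^ 2 := by nlinarith
    calc 16 * σ ^ 2 * ι ≤ 16 * σ ^ 2 * ι ^ 2 := by gcongr
      _ = _ := by ring
  have hεK : ‖ε (K + 1) i‖ ≤ 4 * σ * ι :=
    (sq_le_sq₀ (norm_nonneg _) (by positivity)).1 ((hN.sample K hK i).trans hsq)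
  have hmK : ‖m K‖ ≤ 4 * σ * ι := by
    refine (sq_le_sq₀ (norm_nonneg _) (by positivity)).1 ((hN.local_avg K hK i).trans
      (le_trans ?_ hsq))
    have : 16 * β ≤ 16 := by linarith
    gcongr
  have e : v (K + 1) - v K
      = β • ((ε (K + 1) i - m K) + ((A (K + 1) - A K) - (v K - A K - m K))) := by
    rw [hvs K]
    module
  have hsum : ‖(ε (K + 1) i - m K) + ((A (K + 1) - A K) - (v K - A K - m K))‖
      ≤ 8 * ι * (σ + B + √(L * Δ)) := by
    have h1 := norm_add_le (ε (K + 1) i - m K) ((A (K + 1) - A K) - (v K - A K - m K))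
    have h2 := norm_sub_le (ε (K + 1) i) (m K)
    have h3 := norm_sub_le (A (K + 1) - A K) (v K - A K - m K)
    have h4 : B ≤ ι * B := le_mul_of_one_le_left hB0 hι
    have h5 : 0 ≤ ι * B := by positivity
    linarith
  change ‖v (K + 1) - v K‖ ≤ _
  rw [e, norm_smul, Real.norm_of_nonneg hβ.le]
  calc β * _ ≤ β * (8 * ι * (σ + B + √(L * Δ))) := by gcongr
    _ = _ := by ring

/-- Under the noise bounds no worker ever clips, and the run converges. -/
theorem sum_norm_gradient_sq_le (hn : 1 ≤ n) (hf : SmoothProblem L f) (hL : 0 < L) (hβ : 0 < β)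
    (hβ1 : β ≤ 1) (hq : 0 < q) (hq1 : q ≤ 1) (hγ : γ = q ^ 2 / 108 * β / L) (hσ : 0 ≤ σ)
    (hι : 1 ≤ ι) (hτ : 0 ≤ τ) (hΔ : avgLoss f x0 - (⨅ x, avgLoss f x) ≤ Δ)
    (hB : ∀ i, ‖gradient (f i) x0‖ ≤ B)
    (hN : NoiseBounds (noise f γ β q τ G x0 s) β σ ι T) (hβσ : β ^ 2 * T * σ ^ 2 ≤ n * L * Δ)
    (hβτ : 8 * β * ι * (σ + B + √(L * Δ)) ≤ q * τ) (hT : 1 ≤ T) :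
    γ / 2 * ∑ t ∈ Finset.range T, ‖gradient (avgLoss f) (run γ β q τ G x0 s t).x‖ ^ 2
      ≤ 4 * ι * Δ := by
  have hγ0 : 0 < γ := by rw [hγ]; positivity
  have hΔ0 : 0 ≤ Δ := by linarith [ciInf_le hf.bddBelow x0]
  have hclip : ∀ K ≤ T, NoClip γ β q τ G x0 s K := by
    intro K
    induction K with
    | zero => exact fun _ t ht => absurd ht (Nat.not_lt_zero t)
    | succ K ih =>
      intro hK t ht i
      have hKc := ih (by omega)
      rcases Nat.lt_succ_iff_lt_or_eq.1 ht with ht | rfl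
      · exact hKc t ht i
      · have h1 := sum_norm_sq_le_of_noClip hn hf hL hβ hβ1 hq hq1 hγ hι hΔ hN hβσ
          (by omega : t < T) hKc
        have h2 := norm_v_succ_sub_v_le hf hL hβ hβ1 hq hq1 hγ hσ hι hΔ0 hB hN (by omega : t < T)
          (le_trans (le_add_of_nonneg_left (mul_nonneg (by positivity)
            (Finset.sum_nonneg fun _ _ => sq_nonneg _))) h1) i
        have h3 := norm_gl_sub_v_le_of_noClip hq1 hτ hKc i
        -- The new gap is at most `q τ + (1 - q) τ = τ`, so the threshold is never crossed.
        have h4 := norm_sub_le ((run γ β q τ G x0 s (t + 1)).v i - (run γ β q τ G x0 s t).v i)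
          ((run γ β q τ G x0 s t).gl i - (run γ β q τ G x0 s t).v i)
        rw [sub_sub_sub_cancel_right] at h4
        linarith
  -- The energy estimate sums over `K + 1` iterates but needs only `K` unclipped steps.
  obtain ⟨K, rfl⟩ : ∃ K, T = K + 1 := ⟨T - 1, by omega⟩
  have h1 := sum_norm_sq_le_of_noClip hn hf hL hβ hβ1 hq hq1 hγ hι hΔ hN hβσ
    (Nat.lt_succ_self K) (hclip K (by omega))
  have : 0 ≤ γ / 8 * ∑ t ∈ Finset.range (K + 1), ‖(run γ β q τ G x0 s t).g‖ ^ 2 :=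
    mul_nonneg (by positivity) (Finset.sum_nonneg fun _ _ => sq_nonneg _)
  linarith

end Run

/-! ### Union bound for the noise event. -/

section Probability

variable {n d : ℕ} {Ξ Ω : Type*} [MeasurableSpace Ξ] [MeasurableSpace Ω] {P : Measure Ω}
  [IsProbabilityMeasure P] {D : Fin n → Measure Ξ} {ξ : ℕ → Fin n → Ω → Ξ} {f : Fin n → E d → ℝ}
  {G : Fin n → E d → Ξ → E d} {σ : ℝ}

theorem SmoothProblem.measurable_gradient {L : ℝ} (hf : SmoothProblem L f) (i : Fin n) :
    Measurable (gradient (f i)) :=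
  (LipschitzWith.of_dist_le_mul (K := L.toNNReal) fun x y => by
    rw [dist_eq_norm, dist_eq_norm]
    refine (hf.smooth i x y).trans ?_
    gcongr
    exact Real.le_coe_toNNReal L).continuous.measurable

theorem measure_movingAvg_gt_le (hσ : 0 ≤ σ) (hf : ∀ i, Measurable (gradient (f i)))
    (hG : SubGaussianOracle σ f D G) (hξ : IndepSamples P D ξ) (γ β β' τ : ℝ) (x0 : E d) {b : ℝ}
    (hb : 0 ≤ b) (hb1 : b ≤ 1) (w : Fin n → ℝ) (t : ℕ) (ι : ℝ) :
    P {ω | 2 * (b * ∑ i, w i ^ 2 * (8 * σ ^ 2)) * ι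
      < ‖movingAvg b w (noise f γ β β' τ G x0 (fun t i => ξ t i ω)) t‖ ^ 2} ≤ eexp (1 - ι) :=
  (hasGaussianNorm_movingAvg hσ hf hG hξ γ β β' τ x0 hb hb1 w t).measure_norm_sq_gt_le
    ((measurable_movingAvg hf γ β β' τ hG.measurable x0 ξ b w t).mono
      (pastSigma_le hξ.measurable t) le_rfl)
    (mul_nonneg hb (Finset.sum_nonneg fun i _ => by positivity)) ι

theorem measure_not_noiseBounds_le (hn : 1 ≤ n) (hσ : 0 ≤ σ)
    (hf : ∀ i, Measurable (gradient (f i))) (hG : SubGaussianOracle σ f D G)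
    (hξ : IndepSamples P D ξ) (γ β' τ : ℝ) (x0 : E d) {β : ℝ} (hβ : 0 ≤ β) (hβ1 : β ≤ 1) (T : ℕ)
    (ι : ℝ) :
    P {ω | ¬ NoiseBounds (noise f γ β β' τ G x0 (fun t i => ξ t i ω)) β σ ι T}
      ≤ (3 * n * T : ℕ) * eexp (1 - ι) := by
  have hn0 : (n : ℝ) ≠ 0 := by positivity
  let ε : Ω → ℕ → Fin n → E d := fun ω => noise f γ β β' τ G x0 (fun t i => ξ t i ω)
  let A1 : ℕ → Fin n → Set Ω := fun t i => {ω | 16 * σ ^ 2 * ι < ‖ε ω (t + 1) i‖ ^ 2}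
  let A2 : ℕ → Fin n → Set Ω := fun t i =>
    {ω | 16 * β * σ ^ 2 * ι < ‖movingAvg β (Pi.single i 1) (ε ω) t‖ ^ 2}
  let A3 : ℕ → Set Ω := fun t =>
    {ω | 16 * β * (σ ^ 2 / n) * ι < ‖movingAvg β (fun _ => 1 / (n : ℝ)) (ε ω) t‖ ^ 2}
  have hsingle : ∀ i : Fin n, ∑ j, (Pi.single i 1 : Fin n → ℝ) j ^ 2 * (8 * σ ^ 2) = 8 * σ ^ 2 :=
    fun i => by simp [Pi.single_apply]
  have h1 : ∀ t i, P (A1 t i) ≤ eexp (1 - ι) := fun t i => by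
    -- A single sample is a moving average with parameter `1` and weight on one worker.
    have h := measure_movingAvg_gt_le hσ hf hG hξ γ β β' τ x0 zero_le_one le_rfl
      (Pi.single i 1) (t + 1) ι
    simp only [hsingle, movingAvg_single_succ, sub_self, zero_smul, one_smul, zero_add] at h
    refine le_trans (le_of_eq ?_) h
    congr! 4
    ring
  have h2 : ∀ t i, P (A2 t i) ≤ eexp (1 - ι) := fun t i => by
    have h := measure_movingAvg_gt_le hσ hf hG hξ γ β β' τ x0 hβ hβ1 (Pi.single i 1) t ι
    simp only [hsingle] at h
    refine le_trans (le_of_eq ?_) h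
    congr! 4
    ring
  have h3 : ∀ t, P (A3 t) ≤ eexp (1 - ι) := fun t => by
    have h := measure_movingAvg_gt_le hσ hf hG hξ γ β β' τ x0 hβ hβ1 (fun _ => 1 / (n : ℝ)) t ι
    simp only [Finset.sum_const, Finset.card_univ, Fintype.card_fin, nsmul_eq_mul] at h
    refine le_trans (le_of_eq ?_) h
    congr! 4
    field_simp
    ring
  have hsub : {ω | ¬ NoiseBounds (ε ω) β σ ι T} ⊆ ⋃ t ∈ Finset.range T,
      ((⋃ i ∈ (Finset.univ : Finset (Fin n)), A1 t i ∪ A2 t i) ∪ A3 t) := by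
    intro ω hω
    by_contra hcon
    simp only [Set.mem_iUnion, Set.mem_union, Finset.mem_range, Finset.mem_univ, not_exists, not_or,
      exists_prop, true_and, not_and] at hcon
    exact hω ⟨fun t ht i => not_lt.1 ((hcon t ht).1 i).1, fun t ht i => not_lt.1 ((hcon t ht).1 i).2,
      fun t ht => not_lt.1 (hcon t ht).2⟩
  calc P {ω | ¬ NoiseBounds (ε ω) β σ ι T}
      ≤ ∑ t ∈ Finset.range T, P ((⋃ i ∈ (Finset.univ : Finset (Fin n)), A1 t i ∪ A2 t i) ∪ A3 t) :=
        (measure_mono hsub).trans (measure_biUnion_finset_le _ _)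
    _ ≤ ∑ _t ∈ Finset.range T, (n * (2 * eexp (1 - ι)) + n * eexp (1 - ι)) := by
        refine Finset.sum_le_sum fun t _ => (measure_union_le _ _).trans (add_le_add ?_ ?_)
        · refine (measure_biUnion_finset_le _ _).trans ?_
          calc ∑ i : Fin n, P (A1 t i ∪ A2 t i) ≤ ∑ _i : Fin n, 2 * eexp (1 - ι) :=
                Finset.sum_le_sum fun i _ => (measure_union_le _ _).trans (by
                  rw [two_mul]
                  exact add_le_add (h1 t i) (h2 t i))
            _ = _ := by simp
        -- One event per time is counted `n` times, merely to reach the total `3 n T`.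
        · refine (h3 t).trans ?_
          calc eexp (1 - ι) = 1 * eexp (1 - ι) := (one_mul _).symm
            _ ≤ n * eexp (1 - ι) := by
                gcongr
                exact_mod_cast hn
    _ = _ := by
        rw [Finset.sum_const, Finset.card_range, nsmul_eq_mul]
        push_cast
        ring

theorem mul_eexp_one_sub_log_le {n T : ℕ} {α : ℝ} (hn : 1 ≤ n) (hα : 0 < α) :
    ((3 * n * T : ℕ) : ENNReal) * eexp (1 - Real.log (12 * n * (T + 1) / α))
      ≤ ENNReal.ofReal α := by
  have hn0 : (0 : ℝ) < n := by exact_mod_cast hn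
  rw [eexp, ← ENNReal.ofReal_natCast, ← ENNReal.ofReal_mul (by positivity)]
  refine ENNReal.ofReal_le_ofReal ?_
  rw [Real.exp_sub, Real.exp_log (by positivity)]
  have h1 : Real.exp 1 ≤ 3 := Real.exp_one_lt_three.le
  calc ((3 * n * T : ℕ) : ℝ) * (Real.exp 1 / (12 * n * (T + 1) / α))
      ≤ ((3 * n * T : ℕ) : ℝ) * (3 / (12 * n * (T + 1) / α)) := by gcongr
    _ = 3 / 4 * (T / (T + 1)) * α := by
        push_cast
        field_simp
        ring
    _ ≤ 1 * α := by
        have : (T : ℝ) / (T + 1) ≤ 1 := by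
          rw [div_le_one (by positivity)]
          linarith
        gcongr
        linarith
    _ = α := one_mul α

theorem one_le_log {n T : ℕ} {α : ℝ} (hn : 1 ≤ n) (hT : 1 ≤ T) (hα : 0 < α) (hα1 : α < 1) :
    1 ≤ Real.log (12 * n * (T + 1) / α) := by
  have hn0 : (1 : ℝ) ≤ n := by exact_mod_cast hn
  have hT0 : (1 : ℝ) ≤ T := by exact_mod_cast hT
  rw [Real.le_log_iff_exp_le (by positivity)]
  refine Real.exp_one_lt_three.le.trans ?_
  rw [le_div_iff₀ hα]
  nlinarith

/-- Monotonicity and subadditivity suffice, so neither set has to be measurable. -/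
theorem ofReal_one_sub_le_of_compl {α : ℝ} (hα : 0 ≤ α) {A N : Set Ω} (hA : Aᶜ ⊆ N)
    (hN : P N ≤ ENNReal.ofReal α) : ENNReal.ofReal (1 - α) ≤ P A := by
  rw [ENNReal.ofReal_sub _ hα, ENNReal.ofReal_one, tsub_le_iff_right, ← measure_univ (μ := P)]
  calc P Set.univ ≤ P (A ∪ N) := measure_mono fun ω _ => by
        by_cases h : ω ∈ A
        · exact Or.inl h
        · exact Or.inr (hA h)
    _ ≤ P A + P N := measure_union_le _ _
    _ ≤ P A + ENNReal.ofReal α := by gcongr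

end Probability

/-! ### From the momentum parameter to the rate. -/

section Parameters

/-- The inverse of the momentum parameter. -/
noncomputable def invMomentum (n T : ℕ) (L Δ B τ σ q ι : ℝ) : ℝ :=
  1 + 8 * ι * (σ + B + √(L * Δ)) / (q * τ) + σ * √T / √(n * (L * Δ))

/-- The three summands of `1 / β` give, in turn, `LΔ / T`, the terms with `τ` in the denominator,
and the statistical term `σ √(LΔ) / √(nT)`. The factor `864 = 8 · 108` comes from `4 ι Δ / (γ / 2)`.
-/
theorem rate_le {n T : ℕ} {L Δ B τ σ q ι : ℝ} (hn : 1 ≤ n) (hT : 1 ≤ T) (hL : 0 < L) (hΔ : 0 < Δ)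
    (hB : 0 ≤ B) (hτ : 0 < τ) (hσ : 0 ≤ σ) (hq : 0 < q) (hq1 : q ≤ 1) (hι : 1 ≤ ι) :
    864 * ι * (L * Δ) / (q ^ 2 * T) * invMomentum n T L Δ B τ σ q ι
      ≤ 6912 / q ^ 3 * ι ^ 2 * (mainRate n T L Δ B τ σ + higherOrder T L Δ τ σ) := by
  have hn0 : (0 : ℝ) < n := by exact_mod_cast hn
  have hT0 : (0 : ℝ) < T := by exact_mod_cast hT
  set r := √(L * Δ) with hr
  have hr0 : 0 < r := by rw [hr]; positivity
  have hLΔ : L * Δ = r ^ 2 := (Real.sq_sqrt (by positivity)).symm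
  have hsn : 0 < √(n : ℝ) := by positivity
  have hsT : 0 < √(T : ℝ) := by positivity
  have hTs : (T : ℝ) = √(T : ℝ) ^ 2 := (Real.sq_sqrt hT0.le).symm
  have h1 : 864 * ι * (L * Δ) / (q ^ 2 * T) ≤ 6912 / q ^ 3 * ι ^ 2 * (L * Δ / T) := by
    have : 864 * ι * (L * Δ) / (q ^ 2 * T) = 864 * (q * ι) / q ^ 3 * (L * Δ / T) := by
      field_simp
    rw [this]
    gcongr ?_ * _
    rw [div_mul_eq_mul_div]
    gcongr ?_ / _
    nlinarith [mul_le_of_le_one_left (by linarith : (0 : ℝ) ≤ ι) hq1]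
  have h2 : 864 * ι * (L * Δ) / (q ^ 2 * T) * (8 * ι * (σ + B + r) / (q * τ))
      = 6912 / q ^ 3 * ι ^ 2 * (L * Δ * (σ + B + r) / (τ * T)) := by
    field_simp
    norm_num
  have h3 : 864 * ι * (L * Δ) / (q ^ 2 * T) * (σ * √T / √(n * (L * Δ)))
      ≤ 6912 / q ^ 3 * ι ^ 2 * (σ * r / √(n * T)) := by
    have e : 864 * ι * (L * Δ) / (q ^ 2 * T) * (σ * √T / √(n * (L * Δ)))
        = 864 * (q * ι) / q ^ 3 * (σ * r / √(n * T)) := by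
      rw [Real.sqrt_mul hn0.le, Real.sqrt_mul hn0.le, ← hr, hLΔ]
      field_simp
      rw [← hTs, mul_comm]
    rw [e]
    gcongr ?_ * _
    rw [div_mul_eq_mul_div]
    gcongr ?_ / _
    nlinarith [mul_le_of_le_one_left (by linarith : (0 : ℝ) ≤ ι) hq1]
  have h4 : L * Δ / T + L * Δ * (σ + B + r) / (τ * T) + σ * r / √(n * T)
      ≤ mainRate n T L Δ B τ σ + higherOrder T L Δ τ σ := by
    rw [mainRate, higherOrder, ← hr]
    have e1 : L * Δ * (1 + B / τ) / T + L * Δ * (r + σ) / (τ * T)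
        = L * Δ / T + L * Δ * (σ + B + r) / (τ * T) := by
      field_simp
      ring
    have e2 : σ * (r + B + σ) / √(n * T) = σ * r / √(n * T) + σ * (B + σ) / √(n * T) := by
      rw [← add_div]
      ring
    -- This part of the rate is not needed and is only added.
    have : 0 ≤ σ * (B + σ) / √(n * T) := by positivity
    linarith
  have h5 := mul_le_mul_of_nonneg_left h4 (by positivity : 0 ≤ 6912 / q ^ 3 * ι ^ 2)
  rw [invMomentum, ← hr, mul_add, mul_add, mul_one, h2]
  linarith

end Parameters

end Clip21

/-! ### The main theorem: choice of parameters and conclusion. -/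

theorem theorem3 :
    -- `k` is the power of the logarithm; `C` depends on the momentum parameter `β'` only
    ∃ k : ℕ, ∀ β' : ℝ, 0 < β' → β' ≤ 1 → ∃ C : ℝ, 0 < C ∧
      ∀ (n T : ℕ) (L Δ B τ σ α : ℝ), 1 ≤ n → 1 ≤ T → 0 < L → 0 < Δ → 0 < τ → 0 ≤ σ →
        0 < α → α < 1 →
        ∃ γ β : ℝ, 0 < γ ∧ 0 < β ∧ β ≤ 1 ∧
          ∀ (d : ℕ) (f : Fin n → Clip21.E d → ℝ) (x0 : Clip21.E d),
            Clip21.SmoothProblem L f →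
            Clip21.avgLoss f x0 - (⨅ x, Clip21.avgLoss f x) ≤ Δ →
            B = (⨆ i, ‖gradient (f i) x0‖) →
            ∀ (Ξ Ω : Type*) [MeasurableSpace Ξ] [MeasurableSpace Ω] (P : Measure Ω)
              [IsProbabilityMeasure P] (D : Fin n → Measure Ξ)
              (G : Fin n → Clip21.E d → Ξ → Clip21.E d) (ξ : ℕ → Fin n → Ω → Ξ),
              Clip21.SubGaussianOracle σ f D G →
              Clip21.IndepSamples P D ξ →
              ENNReal.ofReal (1 - α) ≤
                P {ω | Clip21.avgSqGrad f γ β β' τ G x0 (fun t i => ξ t i ω) T ≤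
                  C * Real.log (12 * n * (T + 1) / α) ^ k *
                    (Clip21.mainRate n T L Δ B τ σ + Clip21.higherOrder T L Δ τ σ)} := by
  -- One logarithm comes from the energy bound `4 ι Δ`, the other from the no-clipping condition
  -- inside `1 / β`.
  refine ⟨2, fun q hq hq1 => ⟨6912 / q ^ 3, by positivity, ?_⟩⟩
  intro n T L Δ B τ σ α hn hT hL hΔ hτ hσ hα hα1
  have hn0 : (0 : ℝ) < n := by exact_mod_cast hn
  have hT0 : (0 : ℝ) < T := by exact_mod_cast hT
  set ι := Real.log (12 * n * (T + 1) / α) with hιdef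
  have hι : 1 ≤ ι := Clip21.one_le_log hn hT hα hα1
  -- `B` is nonnegative in the only relevant case, so its absolute value may be used.
  set X : ℝ := 8 * ι * (σ + |B| + √(L * Δ)) / (q * τ) with hX
  set Y : ℝ := σ * √T / √(n * (L * Δ)) with hY
  have hX0 : 0 ≤ X := by positivity
  have hY0 : 0 ≤ Y := by positivity
  have hinv : Clip21.invMomentum n T L Δ |B| τ σ q ι = 1 + X + Y := rfl
  -- The three requirements are `β ≤ 1`, `β X ≤ 1` (no clipping) and `β Y ≤ 1` (noise below the
  -- energy level); the sum in the denominator meets them all.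
  set β : ℝ := 1 / (1 + X + Y) with hβdef
  have hβ : 0 < β := by positivity
  have hβ1 : β ≤ 1 := by
    rw [hβdef, div_le_one (by positivity)]
    linarith
  have hβX : β * X ≤ 1 := by
    rw [hβdef, one_div_mul_eq_div, div_le_one (by positivity)]
    linarith
  have hβY : β * Y ≤ 1 := by
    rw [hβdef, one_div_mul_eq_div, div_le_one (by positivity)]
    linarith
  refine ⟨q ^ 2 / 108 * β / L, β, by positivity, hβ, hβ1, ?_⟩
  intro d f x0 hf hfΔ hB Ξ Ω _ _ P _ D G ξ hG hξ
  set γ : ℝ := q ^ 2 / 108 * β / L with hγ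
  have hBi : ∀ i, ‖gradient (f i) x0‖ ≤ B := fun i => by
    rw [hB]
    exact le_ciSup (f := fun i => ‖gradient (f i) x0‖) (Set.finite_range _).bddAbove i
  have hB0 : 0 ≤ B := (norm_nonneg _).trans (hBi ⟨0, hn⟩)
  rw [abs_of_nonneg hB0] at hX hinv
  have hβτ : 8 * β * ι * (σ + B + √(L * Δ)) ≤ q * τ := by
    have e : 8 * β * ι * (σ + B + √(L * Δ)) = β * X * (q * τ) := by
      rw [hX]
      field_simp
    rw [e]
    exact mul_le_of_le_one_left (by positivity) hβX
  have hβσ : β ^ 2 * T * σ ^ 2 ≤ n * L * Δ := by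
    have hY2 : Y ^ 2 * (n * L * Δ) = σ ^ 2 * T := by
      rw [hY, div_pow, mul_pow, Real.sq_sqrt hT0.le, Real.sq_sqrt (by positivity)]
      field_simp
    have e : β ^ 2 * T * σ ^ 2 = (β * Y) ^ 2 * (n * L * Δ) := by
      linear_combination (-β ^ 2) * hY2
    rw [e]
    exact mul_le_of_le_one_left (by positivity) (pow_le_one₀ (by positivity) hβY)
  refine Clip21.ofReal_one_sub_le_of_compl hα.le
    (N := {ω | ¬ Clip21.NoiseBounds (Clip21.noise f γ β q τ G x0 (fun t i => ξ t i ω)) β σ ι T})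
    (fun ω hω hN => hω ?_) ((Clip21.measure_not_noiseBounds_le hn hσ hf.measurable_gradient hG hξ γ q τ x0 hβ.le hβ1 T
      ι).trans (Clip21.mul_eexp_one_sub_log_le hn hα))
  have hsum := Clip21.sum_norm_gradient_sq_le hn hf hL hβ hβ1 hq hq1 hγ hσ hι hτ.le hfΔ hBi hN hβσ
    hβτ hT
  have hγ0 : 0 < γ := by positivity
  refine le_trans ?_ (Clip21.rate_le hn hT hL hΔ hB0 hτ hσ hq hq1 hι)
  rw [hinv, Clip21.avgSqGrad]
  calc (1 / (T : ℝ)) * _ ≤ (1 / (T : ℝ)) * (4 * ι * Δ / (γ / 2)) := by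
        gcongr
        rw [le_div_iff₀ (by positivity), mul_comm]
        exact hsum
    _ = 864 * ι * (L * Δ) / (q ^ 2 * T) * (1 + X + Y) := by
        rw [hγ, hβdef]
        field_simp
        norm_num
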